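/- Conventions. Vector spaces are real, $\mathbb T=\{z\in\mathbb C:|z|=1\}$, $\mathbb T_+=\{z\in\mathbb T:\operatorname{Re}z\ge 0\}$, and a subset $X$ of a vector space is symmetric if $-X=X$. For symmetric convex subsets $X,Y$ of a vector space $E$ and $k\ge 1$ put $$d_k(X,Y)=\inf\{c>0:\ \exists\, L\le E \text{ a linear subspace},\ \dim L<k,\ X\subseteq cY+L\}\in[0,\infty].$$ A vector space $E$ with a Hausdorff group topology having a neighborhood basis of $0$ of symmetric convex sets is a *locally convex vector group*; it is a *nuclear vector group* if for every symmetric convex neighborhood $U$ of $0$ there is a symmetric convex neighborhood $W$ of $0$ with $d_k(W,U)\le 1/k$ for all $k\ge1$. An abelian Hausdorff topological group $G$ is *nuclear* if for all integers $m\ge 1$, all $c>0$ and every neighborhood $U$ of $0$ there is a neighborhood $W$ of $0$ for which there exist a vector space $E$, symmetric convex sets $X,Y\subseteq E$ with $d_k(X,Y)\le ck^{-m}$ for all $k\ge 1$, a subgroup $H\le E$ and a homomorphism $\phi:H\to G$ with $W\subseteq\phi(X\cap H)$ and $\phi(Y\cap H)\subseteq U$. For an abelian topological group $G$ let $G^\wedge$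 be the group of continuous homomorphisms $G\to\mathbb T$; for $A\subseteq G$ put $A^\triangleright=\{\chi\in G^\wedge:\chi(A)\subseteq\mathbb T_+\}$. The set $A$ is *quasi-convex* if $A=\{g\in G:\chi(g)\in\mathbb T_+\ \forall\chi\in A^\triangleright\}$, and $G$ is *locally quasi-convex* if it has a neighborhood basis of $0$ of quasi-convex sets. Put $$X_A=\{(x_\chi)\in\mathbb R^{G^\wedge}:\ \exists\, g\in A\ \ \forall\chi\in A^\triangleright:\ e^{2\pi i x_\chi}=\chi(g)\text{ and }|x_\chi|\le 1/4\},\qquad Y_A=\operatorname{conv}(X_A),$$ $$H_0=\{(x_\chi)\in\mathbb R^{G^\wedge}:\ \exists\, g\in G\ \ \forall\chi\in G^\wedge:\ e^{2\pi i x_\chi}=\chi(g)\}.$$ Statement. Let $G$ be a Hausdorff locally quasi-convex abelian topological group. The following assertions are equivalent: (i) $G$ is a nuclear group. (ii) $\mathbb R^{G^\wedge}$, with the group topology for which the sets $Y_U$ ($U$ running through the quasi-convex neighborhoods of $0$ in $G$) form a neighborhood basis of $0$, is a nuclear vector group. (iii) $V_0=\mathbb R^{G^\wedge}$, with the group topology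 for which the sets $\operatorname{conv}(X_U\cap H_0)$ ($U$ running through the quasi-convex neighborhoods of $0$ in $G$) form a neighborhood basis of $0$, is a nuclear vector group. -/

import Mathlib

open Topology Pointwise
open scoped ENNReal

universe u

noncomputable section

/-! ### Kolmogoroff numbers and nuclear vector groups -/

/-- A symmetric and convex subset of a real vector space. -/
def IsSymmConvex {E : Type*} [AddCommGroup E] [Module ℝ E] (X : Set E) : Prop :=
  -X = X ∧ Convex ℝ X

/-- The Kolmogoroff number `d_k(X, Y) ∈ [0, ∞]`: the infimum of all reals `c > 0` such that
`X ⊆ c Y + L` for some linear subspace `L` with `dim L < k`. -/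
def kolmogoroffNumber {E : Type*} [AddCommGroup E] [Module ℝ E]
    (k : ℕ) (X Y : Set E) : ℝ≥0∞ :=
  sInf {a : ℝ≥0∞ | ∃ c : ℝ, 0 < c ∧ a = ENNReal.ofReal c ∧
    ∃ L : Submodule ℝ E, Module.rank ℝ L < (k : Cardinal) ∧ X ⊆ c • Y + (L : Set E)}

/-- A real vector space with a Hausdorff group topology which has a neighborhood basis of `0`
consisting of symmetric and convex sets. -/
def IsLocallyConvexVectorGroup (E : Type*) [AddCommGroup E] [Module ℝ E]
    (t : TopologicalSpace E) : Prop :=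
  IsTopologicalAddGroup E ∧ T2Space E ∧
    ∀ U ∈ 𝓝 (0 : E), ∃ W ∈ 𝓝 (0 : E), IsSymmConvex W ∧ W ⊆ U

/-- A locally convex vector group in which every symmetric convex neighborhood `U` of `0` admits
a symmetric convex neighborhood `W` of `0` with `d_k(W, U) ≤ 1 / k` for all `k ≥ 1`. -/
def IsNuclearVectorGroup (E : Type*) [AddCommGroup E] [Module ℝ E]
    (t : TopologicalSpace E) : Prop :=
  IsLocallyConvexVectorGroup E t ∧
    ∀ U ∈ 𝓝 (0 : E), IsSymmConvex U →
      ∃ W ∈ 𝓝 (0 : E), IsSymmConvex W ∧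
        ∀ k : ℕ, 1 ≤ k → kolmogoroffNumber k W U ≤ 1 / (k : ℝ≥0∞)

/-! ### Nuclear groups -/

/-- The relation `(d_k(A, B)) ≤ (c_k)` for subsets `A`, `B` of an abelian group `G`: it is
witnessed by symmetric convex sets `X`, `Y` in a real vector space `E` with `d_k(X, Y) ≤ c_k`,
a subgroup `H` of `E`, and a homomorphism `φ : H → G` with `A ⊆ φ(X ∩ H)`, `φ(Y ∩ H) ⊆ B`. -/
def KolmogoroffLE {G : Type u} [AddCommGroup G] (A B : Set G) (c : ℕ → ℝ≥0∞) : Prop :=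
  ∃ (E : Type u) (_ : AddCommGroup E) (_ : Module ℝ E) (X Y : Set E)
    (H : AddSubgroup E) (φ : H →+ G),
    IsSymmConvex X ∧ IsSymmConvex Y ∧
    (∀ k : ℕ, 1 ≤ k → kolmogoroffNumber k X Y ≤ c k) ∧
    A ⊆ φ '' {h : H | (h : E) ∈ X} ∧
    φ '' {h : H | (h : E) ∈ Y} ⊆ B

/-- A nuclear group: a Hausdorff abelian topological group such that for all `m ≥ 1`, `c > 0` and
every neighborhood `U` of `0` there is a neighborhood `W` of `0` with
`(d_k(W, U)) ≤ (c k⁻ᵐ)`. -/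
def IsNuclearGroup (G : Type u) [AddCommGroup G] [TopologicalSpace G] : Prop :=
  IsTopologicalAddGroup G ∧ T2Space G ∧
    ∀ m : ℕ, 1 ≤ m → ∀ c : ℝ, 0 < c → ∀ U ∈ 𝓝 (0 : G), ∃ W ∈ 𝓝 (0 : G),
      KolmogoroffLE W U (fun k => ENNReal.ofReal (c / (k : ℝ) ^ m))

/-! ### Characters and quasi-convexity -/

section Characters

variable (G : Type u) [AddCommGroup G] [TopologicalSpace G]

/-- The group `G^∧` of continuous characters of the additive group `G`, that is, of continuous
homomorphisms from `G` to the circle. -/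
abbrev CharGroup : Type u := PontryaginDual (Multiplicative G)

variable {G}

/-- The value `χ(g)` of a character. -/
def CharGroup.eval (χ : CharGroup G) (g : G) : Circle := χ (Multiplicative.ofAdd g)

/-- `𝕋₊ = {z ∈ 𝕋 | Re z ≥ 0}`. -/
def circlePos : Set Circle := {z | 0 ≤ (z : ℂ).re}

/-- The polar `A^▷ = {χ ∈ G^∧ | χ(A) ⊆ 𝕋₊}`. -/
def groupPolar (A : Set G) : Set (CharGroup G) := {χ | ∀ g ∈ A, χ.eval g ∈ circlePos}

/-- The prepolar `B^◁ = {g ∈ G | χ(g) ∈ 𝕋₊ for all χ ∈ B}`. -/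
def groupPrepolar (B : Set (CharGroup G)) : Set G := {g | ∀ χ ∈ B, χ.eval g ∈ circlePos}

/-- `A` is quasi-convex if `A = (A^▷)^◁`. -/
def IsQuasiConvex (A : Set G) : Prop := A = groupPrepolar (groupPolar A)

variable (G) in
/-- There is a neighborhood basis of `0` consisting of quasi-convex sets. -/
def IsLocallyQuasiConvex : Prop :=
  ∀ U ∈ 𝓝 (0 : G), ∃ V ∈ 𝓝 (0 : G), IsQuasiConvex V ∧ V ⊆ U

/-! ### The sets `X_A`, `Y_A`, `H₀` in `ℝ^{G^∧}` -/

/-- `X_A`: all `(x_χ)` for which some `g ∈ A` satisfies `e^{2πi x_χ} = χ(g)` and `|x_χ| ≤ 1/4`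
for all `χ ∈ A^▷`; the coordinates outside `A^▷` are arbitrary. -/
def setX (A : Set G) : Set (CharGroup G → ℝ) :=
  {x | ∃ g ∈ A, ∀ χ ∈ groupPolar A,
    Circle.exp (2 * Real.pi * x χ) = χ.eval g ∧ |x χ| ≤ 1 / 4}

/-- `Y_A = conv(X_A)`. -/
def setY (A : Set G) : Set (CharGroup G → ℝ) := convexHull ℝ (setX A)

variable (G) in
/-- `H₀`: all `(x_χ)` for which some `g ∈ G` satisfies `e^{2πi x_χ} = χ(g)` for all `χ`. -/
def setH₀ : Set (CharGroup G → ℝ) :=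
  {x | ∃ g : G, ∀ χ : CharGroup G, Circle.exp (2 * Real.pi * x χ) = χ.eval g}

/-! ### The two group topologies on `ℝ^{G^∧}` -/

lemma CharGroup.eval_add (χ : CharGroup G) (g h : G) :
    χ.eval (g + h) = χ.eval g * χ.eval h := by
  simp only [CharGroup.eval, ofAdd_add]
  exact map_mul χ _ _

lemma CharGroup.eval_zero (χ : CharGroup G) : χ.eval (0 : G) = 1 := by
  simp only [CharGroup.eval, ofAdd_zero]
  exact map_one χ

lemma CharGroup.eval_neg (χ : CharGroup G) (g : G) : χ.eval (-g) = (χ.eval g)⁻¹ := by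
  simp only [CharGroup.eval, ofAdd_neg]
  exact map_inv χ _

lemma groupPolar_anti {A B : Set G} (h : A ⊆ B) : groupPolar B ⊆ groupPolar A :=
  fun _ hχ g hg => hχ g (h hg)

lemma inv_mem_circlePos {z : Circle} (hz : z ∈ circlePos) : z⁻¹ ∈ circlePos := by
  simpa [circlePos, Circle.coe_inv_eq_conj] using hz

lemma IsQuasiConvex.neg_mem {A : Set G} (hA : IsQuasiConvex A) {g : G} (hg : g ∈ A) :
    -g ∈ A := by
  rw [hA]
  intro χ hχ
  rw [CharGroup.eval_neg]
  exact inv_mem_circlePos (hχ g hg)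

lemma IsQuasiConvex.inter {A B : Set G} (hA : IsQuasiConvex A) (hB : IsQuasiConvex B) :
    IsQuasiConvex (A ∩ B) := by
  apply Set.Subset.antisymm
  · exact fun g hg χ hχ => hχ g hg
  · intro g hg
    refine ⟨?_, ?_⟩
    · rw [hA]
      exact fun χ hχ => hg χ (groupPolar_anti Set.inter_subset_left hχ)
    · rw [hB]
      exact fun χ hχ => hg χ (groupPolar_anti Set.inter_subset_right hχ)

lemma abs_le_quarter_of_exp_mem {t : ℝ} (h1 : |t| ≤ 1 / 2)
    (h2 : Circle.exp (2 * Real.pi * t) ∈ circlePos) : |t| ≤ 1 / 4 := by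
  by_contra! h
  have h3 : 0 ≤ Real.cos (2 * Real.pi * t) := by
    have : 0 ≤ (Complex.exp (((2 * Real.pi * t : ℝ) : ℂ) * Complex.I)).re := h2
    rwa [Complex.exp_ofReal_mul_I_re] at this
  have h4 : Real.cos (2 * Real.pi * t) = Real.cos (2 * Real.pi * |t|) := by
    rw [← Real.cos_abs, abs_mul, abs_of_pos Real.two_pi_pos]
  have h5 : Real.cos (2 * Real.pi * |t|) < 0 := by
    apply Real.cos_neg_of_pi_div_two_lt_of_lt <;> nlinarith [Real.pi_pos]
  linarith

lemma setX_mono {A B : Set G} (h : A ⊆ B) : setX A ⊆ setX B := by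
  rintro x ⟨g, hg, hx⟩
  exact ⟨g, h hg, fun χ hχ => hx χ (groupPolar_anti h hχ)⟩

lemma zero_mem_setX {A : Set G} (h : (0 : G) ∈ A) : (0 : CharGroup G → ℝ) ∈ setX A :=
  ⟨0, h, fun χ _ => by simp [CharGroup.eval_zero]⟩

lemma neg_mem_setX {A : Set G} (hA : IsQuasiConvex A) {x : CharGroup G → ℝ} (hx : x ∈ setX A) :
    -x ∈ setX A := by
  obtain ⟨g, hg, hx⟩ := hx
  refine ⟨-g, hA.neg_mem hg, fun χ hχ => ?_⟩
  obtain ⟨h1, h2⟩ := hx χ hχ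
  refine ⟨?_, by simpa using h2⟩
  rw [CharGroup.eval_neg, ← h1, ← Circle.exp_neg]
  simp

lemma add_mem_setX {A B : Set G} (h0 : (0 : G) ∈ A) (hAB : A + A ⊆ B)
    {x y : CharGroup G → ℝ} (hx : x ∈ setX A) (hy : y ∈ setX A) : x + y ∈ setX B := by
  obtain ⟨g, hg, hx⟩ := hx
  obtain ⟨h, hh, hy⟩ := hy
  have hgh : g + h ∈ B := hAB (Set.add_mem_add hg hh)
  have hsub : A ⊆ B := fun a ha => hAB ⟨a, ha, 0, h0, add_zero a⟩
  refine ⟨g + h, hgh, fun χ hχ => ?_⟩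
  obtain ⟨hx1, hx2⟩ := hx χ (groupPolar_anti hsub hχ)
  obtain ⟨hy1, hy2⟩ := hy χ (groupPolar_anti hsub hχ)
  have he : Circle.exp (2 * Real.pi * (x + y) χ) = χ.eval (g + h) := by
    rw [CharGroup.eval_add, ← hx1, ← hy1, ← Circle.exp_add, Pi.add_apply, mul_add]
  refine ⟨he, abs_le_quarter_of_exp_mem ?_ (he ▸ hχ _ hgh)⟩
  have := abs_add_le (x χ) (y χ)
  simp only [Pi.add_apply]
  linarith

lemma zero_mem_setH₀ : (0 : CharGroup G → ℝ) ∈ setH₀ G :=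
  ⟨0, fun χ => by simp [CharGroup.eval_zero]⟩

lemma neg_mem_setH₀ {x : CharGroup G → ℝ} (hx : x ∈ setH₀ G) : -x ∈ setH₀ G := by
  obtain ⟨g, hg⟩ := hx
  refine ⟨-g, fun χ => ?_⟩
  rw [CharGroup.eval_neg, ← hg, ← Circle.exp_neg]
  simp

lemma add_mem_setH₀ {x y : CharGroup G → ℝ} (hx : x ∈ setH₀ G) (hy : y ∈ setH₀ G) :
    x + y ∈ setH₀ G := by
  obtain ⟨g, hg⟩ := hx
  obtain ⟨h, hh⟩ := hy
  refine ⟨g + h, fun χ => ?_⟩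
  rw [CharGroup.eval_add, ← hg, ← hh, ← Circle.exp_add, Pi.add_apply, mul_add]

/-- For `T : Set G → Set (ℝ^{G^∧})` satisfying the stated compatibilities, the sets `conv (T U)`,
where `U` runs through the quasi-convex neighborhoods of `0` in `G`, are a neighborhood basis of
`0` for a group topology. -/
def quasiConvexFilterBasis [IsTopologicalAddGroup G] (hG : IsLocallyQuasiConvex G)
    (T : Set G → Set (CharGroup G → ℝ))
    (hzero : ∀ U : Set G, (0 : G) ∈ U → 0 ∈ T U)
    (hmono : ∀ U W : Set G, U ⊆ W → T U ⊆ T W)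
    (hneg : ∀ U : Set G, IsQuasiConvex U → ∀ x ∈ T U, -x ∈ T U)
    (hadd : ∀ U W : Set G, (0 : G) ∈ U → U + U ⊆ W → T U + T U ⊆ T W) :
    AddGroupFilterBasis (CharGroup G → ℝ) where
  sets := {S | ∃ U ∈ 𝓝 (0 : G), IsQuasiConvex U ∧ S = convexHull ℝ (T U)}
  nonempty := by
    obtain ⟨V, hV, hq, -⟩ := hG _ Filter.univ_mem
    exact ⟨_, V, hV, hq, rfl⟩
  inter_sets := by
    rintro _ _ ⟨U, hU, hUq, rfl⟩ ⟨W, hW, hWq, rfl⟩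
    exact ⟨_, ⟨U ∩ W, Filter.inter_mem hU hW, hUq.inter hWq, rfl⟩,
      Set.subset_inter (convexHull_mono (hmono _ _ Set.inter_subset_left))
        (convexHull_mono (hmono _ _ Set.inter_subset_right))⟩
  zero' := by
    rintro _ ⟨U, hU, -, rfl⟩
    exact subset_convexHull ℝ _ (hzero U (mem_of_mem_nhds hU))
  add' := by
    rintro _ ⟨U, hU, -, rfl⟩
    obtain ⟨V, hV, hVU⟩ := exists_nhds_zero_half hU
    obtain ⟨W, hW, hWq, hWV⟩ := hG V hV
    refine ⟨_, ⟨W, hW, hWq, rfl⟩, ?_⟩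
    rw [← convexHull_add]
    refine convexHull_mono (hadd _ _ (mem_of_mem_nhds hW) ?_)
    rintro _ ⟨a, ha, b, hb, rfl⟩
    exact hVU a (hWV ha) b (hWV hb)
  neg' := by
    rintro _ ⟨U, hU, hUq, rfl⟩
    refine ⟨_, ⟨U, hU, hUq, rfl⟩, ?_⟩
    change _ ⊆ -convexHull ℝ (T U)
    rw [← convexHull_neg]
    exact convexHull_mono fun x hx => hneg U hUq x hx
  conj' := by
    rintro x₀ _ ⟨U, hU, hUq, rfl⟩
    exact ⟨_, ⟨U, hU, hUq, rfl⟩, fun x hx => by simpa using hx⟩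

/-- The sets `Y_U`, `U` a quasi-convex neighborhood of `0` in `G`. -/
def filterBasisY [IsTopologicalAddGroup G] (hG : IsLocallyQuasiConvex G) :
    AddGroupFilterBasis (CharGroup G → ℝ) :=
  quasiConvexFilterBasis hG (fun U => setX U)
    (fun _ h => zero_mem_setX h)
    (fun _ _ h => setX_mono h)
    (fun _ hU _ hx => neg_mem_setX hU hx)
    (by
      rintro U W h0 h _ ⟨x, hx, y, hy, rfl⟩
      exact add_mem_setX h0 h hx hy)

/-- The sets `conv(X_U ∩ H₀)`, `U` a quasi-convex neighborhood of `0` in `G`. -/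
def filterBasisV₀ [IsTopologicalAddGroup G] (hG : IsLocallyQuasiConvex G) :
    AddGroupFilterBasis (CharGroup G → ℝ) :=
  quasiConvexFilterBasis hG (fun U => setX U ∩ setH₀ G)
    (fun _ h => ⟨zero_mem_setX h, zero_mem_setH₀⟩)
    (fun _ _ h => Set.inter_subset_inter_left _ (setX_mono h))
    (fun _ hU _ hx => ⟨neg_mem_setX hU hx.1, neg_mem_setH₀ hx.2⟩)
    (by
      rintro U W h0 h _ ⟨x, hx, y, hy, rfl⟩
      exact ⟨add_mem_setX h0 h hx.1 hy.1, add_mem_setH₀ hx.2 hy.2⟩)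

/-- The group topology on `ℝ^{G^∧}` with neighborhood basis `(Y_U)` of `0`. -/
def topologyY [IsTopologicalAddGroup G] (hG : IsLocallyQuasiConvex G) :
    TopologicalSpace (CharGroup G → ℝ) :=
  (filterBasisY hG).topology

/-- The group topology on `ℝ^{G^∧}` with neighborhood basis `(conv(X_U ∩ H₀))` of `0`; the space
`V₀` is `ℝ^{G^∧}` with this topology. -/
def topologyV₀ [IsTopologicalAddGroup G] (hG : IsLocallyQuasiConvex G) :
    TopologicalSpace (CharGroup G → ℝ) :=
  (filterBasisV₀ hG).topology

lemma mem_nhds_topologyY [IsTopologicalAddGroup G] (hG : IsLocallyQuasiConvex G)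
    (S : Set (CharGroup G → ℝ)) :
    S ∈ @nhds _ (topologyY hG) 0 ↔
      ∃ U ∈ 𝓝 (0 : G), IsQuasiConvex U ∧ setY U ⊆ S := by
  refine (filterBasisY hG).nhds_zero_hasBasis.mem_iff.trans ⟨?_, ?_⟩
  · rintro ⟨_, ⟨U, hU, hUq, rfl⟩, h⟩
    exact ⟨U, hU, hUq, h⟩
  · rintro ⟨U, hU, hUq, h⟩
    exact ⟨_, ⟨U, hU, hUq, rfl⟩, h⟩

lemma mem_nhds_topologyV₀ [IsTopologicalAddGroup G] (hG : IsLocallyQuasiConvex G)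
    (S : Set (CharGroup G → ℝ)) :
    S ∈ @nhds _ (topologyV₀ hG) 0 ↔
      ∃ U ∈ 𝓝 (0 : G), IsQuasiConvex U ∧ convexHull ℝ (setX U ∩ setH₀ G) ⊆ S := by
  refine (filterBasisV₀ hG).nhds_zero_hasBasis.mem_iff.trans ⟨?_, ?_⟩
  · rintro ⟨_, ⟨U, hU, hUq, rfl⟩, h⟩
    exact ⟨U, hU, hUq, h⟩
  · rintro ⟨U, hU, hUq, h⟩
    exact ⟨_, ⟨U, hU, hUq, rfl⟩, h⟩

end Characters

end

noncomputable section

/-! ### Symmetric convex sets, approximation by subspaces, rounding of real combinations. -/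

section SymmConvex

variable {E : Type*} [AddCommGroup E] [Module ℝ E] {X Y : Set E}

/-! The cycle (i) ⇒ (iii) ⇒ (ii) ⇒ (i) is proved, and the first implication carries the weight. A
witness of nuclearity is a homomorphism `φ : H → G` with `X` thin in `Y`; the obstacle is that `χ ∘
φ` lives only on the subgroup `H` and has real lifts only modulo the integers.

Two principles overcome this. Rounding: if `d_k(X, Y) ≤ δ_k` with `∑ k δ_k` small, every real
combination of points of `X` differs from some integer combination by an element of a small multiple
of `Y` (`roundsInto_of_approxBy`). So the subgroup generated by `X ∩ H` fills its span well: small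
vectors of the span lie in a multiple of the convex hull of the points of `Y` in the subgroup
(`mem_convexHull_of_roundsInto`), and the small lift of `χ ∘ φ` on `X ∩ H` extends to a linear
functional (`exists_linear_of_additive_mod_int`). Selection: nearly maximal determinants allow the
approximating subspaces to be taken inside the span of the approximated set, at the cost of a factor
of order `k` (`ApproxBy.inter_span`). The functionals carry the estimate to `ℝ^{G^∧}`, and applying
both principles again, to the subgroup `H₀`, gives the estimate between the sets `conv(X_U ∩ H₀)`.
Decay `k⁻⁴` pays for all losses.

For (iii) ⇒ (ii), `Y_U` ignores coordinates outside the polar of `U`, and changing such coordinates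
moves `X_W` into `H₀`. For (ii) ⇒ (i), the natural map `H₀ → G` is the required witness, once
composing estimates has improved the decay `1/k` to any power
(`IsNuclearVectorGroup.exists_approxBy`). -/

lemma IsSymmConvex.neg_mem (hY : IsSymmConvex Y) {x : E} (hx : x ∈ Y) : -x ∈ Y := by
  rw [← hY.1] at hx
  exact hx

lemma IsSymmConvex.zero_mem (hY : IsSymmConvex Y) (hne : Y.Nonempty) : (0 : E) ∈ Y := by
  obtain ⟨x, hx⟩ := hne
  have := hY.2 hx (hY.neg_mem hx) (by norm_num : (0 : ℝ) ≤ 1 / 2) (by norm_num : (0 : ℝ) ≤ 1 / 2)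
    (by norm_num)
  simpa using this

lemma IsSymmConvex.smul (hY : IsSymmConvex Y) (a : ℝ) : IsSymmConvex (a • Y) :=
  ⟨by rw [← Set.smul_set_neg, hY.1], hY.2.smul a⟩

lemma isSymmConvex_convexHull {S : Set E} (hS : ∀ x ∈ S, -x ∈ S) :
    IsSymmConvex (convexHull ℝ S) := by
  refine ⟨?_, convex_convexHull ℝ S⟩
  rw [← convexHull_neg]
  congr 1
  ext x
  exact ⟨fun hx => by simpa using hS _ hx, fun hx => hS _ hx⟩

lemma IsSymmConvex.zero_mem_smul (h0 : (0 : E) ∈ Y) (a : ℝ) : (0 : E) ∈ a • Y :=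
  ⟨0, h0, smul_zero a⟩

lemma IsSymmConvex.smul_mem_smul (hY : IsSymmConvex Y) (h0 : (0 : E) ∈ Y) {a b t : ℝ}
    (h : |t| * a ≤ b) (ha : 0 ≤ a) {x : E} (hx : x ∈ a • Y) : t • x ∈ b • Y := by
  obtain ⟨y, hy, rfl⟩ := hx
  have hta : |t * a| ≤ b := by rwa [abs_mul, abs_of_nonneg ha]
  have hb : 0 ≤ b := (abs_nonneg _).trans hta
  rcases hb.eq_or_lt with rfl | hb
  · have : t * a = 0 := abs_eq_zero.1 (le_antisymm hta (abs_nonneg _))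
    refine ⟨0, h0, ?_⟩
    simp [smul_smul, this]
  · refine ⟨(t * a / b) • y, ?_, ?_⟩
    · rcases le_total 0 (t * a) with h1 | h1
      · refine hY.2.smul_mem_of_zero_mem h0 hy ⟨by positivity, ?_⟩
        rw [div_le_one hb]
        exact (le_abs_self _).trans hta
      · have : (t * a / b) • y = (-(t * a) / b) • (-y) := by
          rw [smul_neg, ← neg_smul]
          congr 1
          ring
        rw [this]
        refine hY.2.smul_mem_of_zero_mem h0 (hY.neg_mem hy) ⟨by
          apply div_nonneg _ hb.le
          linarith, ?_⟩
        rw [div_le_one hb]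
        exact (neg_le_abs _).trans hta
    · simp only [smul_smul]
      congr 1
      field_simp

lemma IsSymmConvex.smul_mono (hY : IsSymmConvex Y) (h0 : (0 : E) ∈ Y) {a b : ℝ}
    (ha : 0 ≤ a) (h : a ≤ b) : a • Y ⊆ b • Y := fun x hx => by
  simpa using hY.smul_mem_smul h0 (t := 1) (by simpa using h) ha hx

lemma IsSymmConvex.add_mem_smul (hY : IsSymmConvex Y) {a b : ℝ}
    (ha : 0 ≤ a) (hb : 0 ≤ b) {x y : E} (hx : x ∈ a • Y) (hy : y ∈ b • Y) :
    x + y ∈ (a + b) • Y := by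
  rw [hY.2.add_smul ha hb]
  exact Set.add_mem_add hx hy

lemma IsSymmConvex.neg_mem_smul (hY : IsSymmConvex Y) {a : ℝ} {x : E} (hx : x ∈ a • Y) :
    -x ∈ a • Y :=
  (hY.smul a).neg_mem hx

lemma IsSymmConvex.sub_mem_smul (hY : IsSymmConvex Y) {a b : ℝ}
    (ha : 0 ≤ a) (hb : 0 ≤ b) {x y : E} (hx : x ∈ a • Y) (hy : y ∈ b • Y) :
    x - y ∈ (a + b) • Y := by
  rw [sub_eq_add_neg]
  exact hY.add_mem_smul ha hb hx (hY.neg_mem_smul hy)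

lemma IsSymmConvex.sum_mem_smul (hY : IsSymmConvex Y) (h0 : (0 : E) ∈ Y) {ι : Type*}
    (s : Finset ι) {a : ι → ℝ} (ha : ∀ i ∈ s, 0 ≤ a i) {f : ι → E}
    (hf : ∀ i ∈ s, f i ∈ a i • Y) : ∑ i ∈ s, f i ∈ (∑ i ∈ s, a i) • Y := by
  classical
  induction s using Finset.induction_on with
  | empty => simpa using IsSymmConvex.zero_mem_smul h0 0
  | insert i s hi ih =>
    rw [Finset.sum_insert hi, Finset.sum_insert hi]
    refine hY.add_mem_smul (ha i (by simp)) (Finset.sum_nonneg fun j hj => ha j (by simp [hj]))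
      (hf i (by simp)) (ih (fun j hj => ha j (by simp [hj])) (fun j hj => hf j (by simp [hj])))

/-- `X ⊆ δ Y + L` for some linear subspace `L` with `dim L < k`. -/
def ApproxBy (k : ℕ) (δ : ℝ) (X Y : Set E) : Prop :=
  ∃ L : Submodule ℝ E, Module.rank ℝ L < (k : Cardinal) ∧ X ⊆ δ • Y + (L : Set E)

lemma ApproxBy.mono_left {k : ℕ} {δ : ℝ} {X' : Set E} (h : ApproxBy k δ X Y) (hX : X' ⊆ X) :
    ApproxBy k δ X' Y := by
  obtain ⟨L, hL, h⟩ := h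
  exact ⟨L, hL, hX.trans h⟩

lemma ApproxBy.mono_right {k : ℕ} {δ : ℝ} {Y' : Set E} (h : ApproxBy k δ X Y) (hY : Y ⊆ Y') :
    ApproxBy k δ X Y' := by
  obtain ⟨L, hL, h⟩ := h
  exact ⟨L, hL, h.trans (Set.add_subset_add_right (Set.smul_set_mono hY))⟩

lemma ApproxBy.mono_const {k : ℕ} {δ δ' : ℝ} (h : ApproxBy k δ X Y) (hY : IsSymmConvex Y)
    (h0 : (0 : E) ∈ Y) (hδ : 0 ≤ δ) (hδ' : δ ≤ δ') : ApproxBy k δ' X Y := by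
  obtain ⟨L, hL, h⟩ := h
  exact ⟨L, hL, h.trans (Set.add_subset_add_right (hY.smul_mono h0 hδ hδ'))⟩

lemma ApproxBy.convexHull {k : ℕ} {δ : ℝ} (h : ApproxBy k δ X Y) (hY : Convex ℝ Y) :
    ApproxBy k δ (convexHull ℝ X) Y := by
  obtain ⟨L, hL, h⟩ := h
  exact ⟨L, hL, convexHull_min h ((hY.smul δ).add L.convex)⟩

lemma ApproxBy.subset_of_one {δ : ℝ} (h : ApproxBy 1 δ X Y) : X ⊆ δ • Y := by
  obtain ⟨L, hL, h⟩ := h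
  have hL0 : Module.rank ℝ L = 0 := by
    rwa [Nat.cast_one, Cardinal.lt_one_iff] at hL
  rw [rank_zero_iff, Submodule.subsingleton_iff_eq_bot] at hL0
  simpa [hL0] using h

lemma kolmogoroffNumber_le_of_approxBy {k : ℕ} {δ : ℝ} (hδ : 0 < δ) (h : ApproxBy k δ X Y) :
    kolmogoroffNumber k X Y ≤ ENNReal.ofReal δ :=
  sInf_le ⟨δ, hδ, rfl, h⟩

lemma approxBy_of_kolmogoroffNumber_lt {k : ℕ} {δ : ℝ} (hY : IsSymmConvex Y)
    (h : kolmogoroffNumber k X Y < ENNReal.ofReal δ) (h0 : (0 : E) ∈ Y) : ApproxBy k δ X Y := by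
  obtain ⟨_, ⟨c, hc, rfl, h'⟩, hlt⟩ := sInf_lt_iff.1 h
  refine ApproxBy.mono_const (δ := c) h' hY h0 hc.le ?_
  exact ((ENNReal.ofReal_lt_ofReal_iff_of_nonneg hc.le).1 hlt).le

/-- Numbers in `[0, 1]` can be moved along a nonzero direction until one of those that move reaches
the boundary. -/
lemma exists_move_to_boundary {ι : Type*} [Fintype ι] {t β : ι → ℝ}
    (ht : ∀ i, t i ∈ Set.Icc (0 : ℝ) 1)
    (hne : ∃ i, β i ≠ 0) :
    ∃ s : ℝ, (∀ i, t i + s * β i ∈ Set.Icc (0 : ℝ) 1) ∧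
      ∃ i, β i ≠ 0 ∧ (t i + s * β i = 0 ∨ t i + s * β i = 1) := by
  classical
  -- The time at which a moving coordinate leaves `[0, 1]`; the least such time stops the motion.
  set r : ι → ℝ := fun i => (if 0 < β i then 1 - t i else t i) / |β i| with hr
  obtain ⟨i, hi, hmin⟩ := Finset.exists_min_image (Finset.univ.filter fun i => β i ≠ 0) r
    (by obtain ⟨i, hi⟩ := hne; exact ⟨i, by simpa using hi⟩)
  have hi' : β i ≠ 0 := by simpa using hi
  have hri : 0 ≤ r i := by
    apply div_nonneg _ (abs_nonneg _)
    split_ifs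
    · linarith [(ht i).2]
    · exact (ht i).1
  refine ⟨r i, fun j => ?_, i, hi', ?_⟩
  · by_cases hj : β j = 0
    · simpa [hj] using ht j
    have hle : r i * |β j| ≤ (if 0 < β j then 1 - t j else t j) := by
      rw [← le_div_iff₀ (abs_pos.2 hj)]
      exact hmin j (by simpa using hj)
    rcases lt_or_ge 0 (β j) with h | h
    · rw [if_pos h, abs_of_pos h] at hle
      exact ⟨add_nonneg (ht j).1 (mul_nonneg hri h.le), by linarith⟩
    · rw [if_neg h.not_gt, abs_of_nonpos h] at hle
      have := mul_nonneg hri (neg_nonneg.2 h)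
      exact ⟨by linarith, by linarith [(ht j).2]⟩
  · rcases lt_or_ge 0 (β i) with h | h
    · right
      simp only [hr, if_pos h, abs_of_pos h]
      field_simp
      ring
    · left
      have h' : β i < 0 := lt_of_le_of_ne h hi'
      simp only [hr, if_neg h.not_gt, abs_of_nonpos h]
      field_simp
      ring

/-- Fractional coefficients are removed one at a time. With `m + 1` of them left, write `x i = a i +
l i` with `a i ∈ δ (m + 1) • Y` and `l i` in a space of dimension at most `m`. Moving the
coefficients along a linear dependence of the `l i` until one becomes integral alters the sum only
through the `a i`. Each coefficient stays in `[0, 1]` and so moves by at most `1`, whence the error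
`(m + 1) δ (m + 1)`. -/
lemma exists_rounding_of_mem_Icc (hY : IsSymmConvex Y) (h0 : (0 : E) ∈ Y) {δ : ℕ → ℝ}
    (hδ : ∀ k, 0 ≤ δ k) (hX : ∀ k, 1 ≤ k → ApproxBy k (δ k) X Y) {ι : Type} [Fintype ι]
    {x : ι → E} (hx : ∀ i, x i ∈ X) (m : ℕ) (t : ι → ℝ) (ht : ∀ i, t i ∈ Set.Icc (0 : ℝ) 1)
    (hm : (Finset.univ.filter fun i => 0 < t i ∧ t i < 1).card ≤ m) :
    ∃ z : ι → ℤ, (∀ i, (z i : ℝ) ∈ Set.Icc (0 : ℝ) 1) ∧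
      ∑ i, (t i - z i) • x i ∈ (∑ k ∈ Finset.range m, ((k + 1 : ℕ) : ℝ) * δ (k + 1)) • Y := by
  classical
  have hpos : ∀ m : ℕ, 0 ≤ ∑ k ∈ Finset.range m, ((k + 1 : ℕ) : ℝ) * δ (k + 1) := fun m =>
    Finset.sum_nonneg fun k _ => mul_nonneg (Nat.cast_nonneg _) (hδ _)
  induction m generalizing t with
  | zero =>
    have hint : ∀ i, t i = 0 ∨ t i = 1 := by
      intro i
      by_contra! h
      have : i ∈ Finset.univ.filter fun i => 0 < t i ∧ t i < 1 := by
        simp [lt_of_le_of_ne (ht i).1 h.1.symm, lt_of_le_of_ne (ht i).2 h.2]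
      rw [Finset.card_eq_zero.1 (Nat.le_zero.1 hm)] at this
      simp at this
    refine ⟨fun i => if t i = 0 then 0 else 1, fun i => ?_, ?_⟩
    · dsimp only
      split_ifs <;> simp
    · have : ∀ i, t i - ((if t i = 0 then 0 else 1 : ℤ) : ℝ) = 0 := by
        intro i
        rcases hint i with h | h <;> simp [h]
      simp only [this, zero_smul, Finset.sum_const_zero]
      exact IsSymmConvex.zero_mem_smul h0 _
  | succ m ih =>
    set F := Finset.univ.filter fun i => 0 < t i ∧ t i < 1 with hF
    have hFmem : ∀ i, i ∈ F ↔ 0 < t i ∧ t i < 1 := by simp [hF]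
    rcases Nat.lt_or_ge F.card (m + 1) with hlt | hge
    · obtain ⟨z, hz, hmem⟩ := ih t ht (Nat.lt_succ_iff.1 hlt)
      refine ⟨z, hz, hY.smul_mono h0 (hpos m) ?_ hmem⟩
      rw [Finset.sum_range_succ]
      have : 0 ≤ ((m + 1 : ℕ) : ℝ) * δ (m + 1) := mul_nonneg (Nat.cast_nonneg _) (hδ _)
      linarith
    have hcard : F.card = m + 1 := le_antisymm hm hge
    obtain ⟨L, hL, hXL⟩ := hX (m + 1) (by omega)
    choose a ha l hl hal using fun i => hXL (hx i)
    have hdep : ¬ LinearIndependent ℝ fun i : F => (⟨l i, hl i⟩ : L) := by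
      intro h
      have := h.cardinal_lift_le_rank
      simp only [Cardinal.mk_coe_finset, hcard, Cardinal.lift_natCast, Cardinal.lift_id'] at this
      exact absurd hL (not_lt.2 (by simpa using this))
    obtain ⟨g, hg, i₀, hi₀⟩ := Fintype.not_linearIndependent_iff.1 hdep
    set β : ι → ℝ := fun i => if h : i ∈ F then g ⟨i, h⟩ else 0 with hβ
    have hβF : ∀ i, β i ≠ 0 → i ∈ F := by
      intro i hi
      by_contra h
      simp [hβ, h] at hi
    have hβl : ∑ i ∈ F, β i • l i = 0 := by
      have h1 : ∑ i : F, g i • l i = 0 := by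
        simpa using congrArg (Submodule.subtype L) hg
      rw [← Finset.sum_coe_sort, ← h1]
      refine Finset.sum_congr rfl fun i _ => ?_
      simp [hβ]
    obtain ⟨s, hs, i₁, hi₁, hs₁⟩ := exists_move_to_boundary (β := β) ht
      ⟨i₀, by simpa [hβ] using hi₀⟩
    set t' : ι → ℝ := fun i => t i + s * β i with ht'
    have hsub : (Finset.univ.filter fun i => 0 < t' i ∧ t' i < 1) ⊂ F := by
      refine Finset.ssubset_iff_subset_ne.2 ⟨fun i hi => ?_, fun h => ?_⟩
      · by_contra hiF
        have : β i = 0 := by simp [hβ, hiF]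
        apply hiF
        simpa [ht', this, hFmem] using hi
      · have : i₁ ∈ Finset.univ.filter fun i => 0 < t' i ∧ t' i < 1 := h ▸ hβF i₁ hi₁
        simp only [Finset.mem_filter, ht'] at this
        rcases hs₁ with h | h <;> rw [h] at this <;> norm_num at this
    obtain ⟨z, hz, hmem⟩ := ih t' hs (by have := Finset.card_lt_card hsub; omega)
    refine ⟨z, hz, ?_⟩
    have hsplit : ∑ i, (t i - z i) • x i =
        ∑ i, (t' i - z i) • x i + ∑ i ∈ F, (-(s * β i)) • a i := by
      have h1 : ∑ i ∈ F, (-(s * β i)) • a i = ∑ i ∈ F, (-(s * β i)) • x i := by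
        have h2 : ∑ i ∈ F, (-(s * β i)) • l i = 0 := by
          have : ∀ i, (-(s * β i)) • l i = (-s) • (β i • l i) := fun i => by
            rw [smul_smul, neg_mul]
          simp only [this, ← Finset.smul_sum, hβl, smul_zero]
        rw [← add_zero (∑ i ∈ F, (-(s * β i)) • a i), ← h2, ← Finset.sum_add_distrib]
        refine Finset.sum_congr rfl fun i _ => ?_
        rw [← smul_add]
        exact congrArg _ (hal i)
      rw [h1, Finset.sum_subset (Finset.subset_univ F) (f := fun i => (-(s * β i)) • x i),
        ← Finset.sum_add_distrib]
      · refine Finset.sum_congr rfl fun i _ => ?_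
        rw [← add_smul]
        congr 1
        simp only [ht']
        ring
      · intro i _ hi
        simp [hβ, hi]
    rw [hsplit, Finset.sum_range_succ]
    refine hY.add_mem_smul (hpos m) (mul_nonneg (Nat.cast_nonneg _) (hδ _)) hmem ?_
    have := hY.sum_mem_smul h0 F (a := fun _ => δ (m + 1)) (fun _ _ => hδ _)
      (f := fun i => (-(s * β i)) • a i) (fun i _ => ?_)
    · simpa [hcard] using this
    · refine hY.smul_mem_smul h0 ?_ (hδ _) (ha i)
      refine mul_le_of_le_one_left (hδ _) ?_
      have h1 := hs i
      have h2 := ht i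
      rw [abs_le]
      constructor <;> linarith [h1.1, h1.2, h2.1, h2.2]

/-- Every real combination of elements of `T` can be rounded to an integer combination with an
error in `Y`. -/
def RoundsInto (T Y : Set E) : Prop :=
  ∀ (n : ℕ) (x : Fin n → E), (∀ i, x i ∈ T) → ∀ t : Fin n → ℝ,
    ∃ z : Fin n → ℤ, (∀ i, |t i - z i| ≤ 1) ∧ ∑ i, (t i - z i) • x i ∈ Y

lemma RoundsInto.mono {T T' Y Y' : Set E} (h : RoundsInto T Y) (hT : T' ⊆ T) (hY : Y ⊆ Y') :
    RoundsInto T' Y' := fun n x hx t => by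
  obtain ⟨z, hz, hmem⟩ := h n x (fun i => hT (hx i)) t
  exact ⟨z, hz, hY hmem⟩

/-- Only fractional parts need rounding, and the number of terms does not matter because the partial
sums of `k δ k` are bounded uniformly. -/
theorem roundsInto_of_approxBy (hY : IsSymmConvex Y) (h0 : (0 : E) ∈ Y) {δ : ℕ → ℝ}
    (hδ : ∀ k, 0 ≤ δ k) (hX : ∀ k, 1 ≤ k → ApproxBy k (δ k) X Y) {μ : ℝ}
    (hμ : ∀ n, ∑ k ∈ Finset.range n, ((k + 1 : ℕ) : ℝ) * δ (k + 1) ≤ μ) :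
    RoundsInto X (μ • Y) := by
  classical
  intro n x hx t
  obtain ⟨z, hz, hmem⟩ := exists_rounding_of_mem_Icc hY h0 hδ hX hx n (fun i => Int.fract (t i))
    (fun i => ⟨Int.fract_nonneg _, (Int.fract_lt_one _).le⟩)
    ((Finset.card_le_univ _).trans_eq (by simp))
  have hfract : ∀ i, t i - ((⌊t i⌋ + z i : ℤ) : ℝ) = Int.fract (t i) - z i := fun i => by
    rw [Int.fract]
    push_cast
    ring
  refine ⟨fun i => ⌊t i⌋ + z i, fun i => ?_, ?_⟩
  · rw [hfract, abs_le]
    have h1 := hz i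
    have h2 := Int.fract_nonneg (t i)
    have h3 := Int.fract_lt_one (t i)
    constructor <;> linarith [h1.1, h1.2]
  · simp only [hfract]
    exact hY.smul_mono h0 (Finset.sum_nonneg fun k _ => mul_nonneg (Nat.cast_nonneg _) (hδ _))
      (hμ n) hmem

lemma sum_intCast_smul_mem_closure {T : Set E} {n : ℕ} {x : Fin n → E} (hx : ∀ i, x i ∈ T)
    (z : Fin n → ℤ) : ∑ i, (z i : ℝ) • x i ∈ AddSubgroup.closure T := by
  refine sum_mem fun i _ => ?_
  rw [Int.cast_smul_eq_zsmul]
  exact zsmul_mem (AddSubgroup.subset_closure (hx i)) _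

/-- If `T ⊆ Y` rounds into `Y / 4`, then the convex hull of the points of `Y` in the subgroup
generated by `T` is large in the linear span of `T`. -/
theorem mem_convexHull_of_roundsInto (hY : IsSymmConvex Y) (h0 : (0 : E) ∈ Y) {T : Set E}
    (hTY : T ⊆ Y) (hT : RoundsInto T ((1 / 4 : ℝ) • Y)) {e : E}
    (he : e ∈ (1 / 4 : ℝ) • Y) (heT : e ∈ Submodule.span ℝ T) :
    e ∈ (2 : ℝ) • convexHull ℝ (Y ∩ AddSubgroup.closure T) := by
  set K := convexHull ℝ (Y ∩ (AddSubgroup.closure T : Set E)) with hK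
  have hKs : IsSymmConvex K := isSymmConvex_convexHull fun x hx => ⟨hY.neg_mem hx.1, neg_mem hx.2⟩
  have hK0 : (0 : E) ∈ K := subset_convexHull ℝ _ ⟨h0, zero_mem _⟩
  obtain ⟨n, f, x', rfl⟩ := Submodule.mem_span_set'.1 heT
  set x : Fin n → E := fun i => x' i with hx'
  have hx : ∀ i, x i ∈ T := fun i => (x' i).2
  -- Rounding `2 t` writes the vector as half a point of `K` plus half a remainder, which lies again
  -- in `Y / 4` but has coefficients at most `1`. The integer combination is in `Y` because `1/2 +
  -- 1/4 ≤ 1`.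
  have hstep : ∀ t : Fin n → ℝ, ∑ i, t i • x i ∈ (1 / 4 : ℝ) • Y →
      ∃ r : Fin n → ℝ, (∀ i, |r i| ≤ 1) ∧ ∑ i, r i • x i ∈ (1 / 4 : ℝ) • Y ∧
        ∃ h ∈ K, ∑ i, t i • x i = (1 / 2 : ℝ) • h + (1 / 2 : ℝ) • ∑ i, r i • x i := by
    intro t ht
    obtain ⟨z, hz, hmem⟩ := hT n x hx fun i => 2 * t i
    have hsum : ∑ i, (2 * t i - z i) • x i =
        (2 : ℝ) • ∑ i, t i • x i - ∑ i, (z i : ℝ) • x i := by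
      simp only [Finset.smul_sum, smul_smul, ← Finset.sum_sub_distrib, ← sub_smul]
    refine ⟨fun i => 2 * t i - z i, hz, hmem, ∑ i, (z i : ℝ) • x i,
      subset_convexHull ℝ _ ⟨?_, sum_intCast_smul_mem_closure hx z⟩, ?_⟩
    · have h1 : ∑ i, (z i : ℝ) • x i =
          (2 : ℝ) • ∑ i, t i • x i - ∑ i, (2 * t i - z i) • x i := by rw [hsum]; abel
      have h2 : (2 : ℝ) • ∑ i, t i • x i ∈ (1 / 2 : ℝ) • Y :=
        hY.smul_mem_smul h0 (by norm_num) (by norm_num) ht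
      have h3 := hY.sub_mem_smul (by norm_num) (by norm_num) h2 hmem
      rw [← h1] at h3
      simpa using hY.smul_mono h0 (by norm_num) (by norm_num : (1 / 2 + 1 / 4 : ℝ) ≤ 1) h3
    · rw [hsum, smul_sub, smul_smul]
      norm_num
  -- Iteration gives a geometric series in `K`. The last remainder is crudely in `n • K`, its
  -- coefficients being at most `1`, and carries the weight `2⁻ᵐ`; no completeness is needed.
  have hiter : ∀ m : ℕ, ∀ r : Fin n → ℝ, (∀ i, |r i| ≤ 1) → ∑ i, r i • x i ∈ (1 / 4 : ℝ) • Y →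
      ∑ i, r i • x i ∈ (1 + (n : ℝ) / 2 ^ m) • K := by
    intro m
    induction m with
    | zero =>
      intro r hr _
      have := hKs.sum_mem_smul hK0 Finset.univ (a := fun _ => (1 : ℝ)) (fun _ _ => zero_le_one)
        (f := fun i => r i • x i) (fun i _ => by
          refine hKs.smul_mem_smul hK0 (a := 1) (by simpa using hr i) zero_le_one ?_
          rw [one_smul]
          exact subset_convexHull ℝ _ ⟨hTY (hx i), AddSubgroup.subset_closure (hx i)⟩)
      refine hKs.smul_mono hK0 (by positivity) ?_ this
      simp
    | succ m ih =>
      intro r hr hrY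
      obtain ⟨r', hr', hrY', h, hh, heq⟩ := hstep r hrY
      have h1 := ih r' hr' hrY'
      rw [heq]
      have h2 : (1 / 2 : ℝ) • h ∈ (1 / 2 : ℝ) • K := ⟨h, hh, rfl⟩
      have h3 := hKs.add_mem_smul (by norm_num) (b := 1 / 2 * (1 + (n : ℝ) / 2 ^ m))
        (by positivity) h2 (hKs.smul_mem_smul hK0 (t := 1 / 2)
          (by rw [abs_of_pos (by norm_num)]) (by positivity) h1)
      convert h3 using 2
      rw [pow_succ]
      field_simp
      ring
  obtain ⟨r, hr, hrY, h, hh, heq⟩ := hstep f he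
  obtain ⟨m, hm⟩ : ∃ m : ℕ, (n : ℝ) / 2 ^ m ≤ 1 :=
    ⟨n, by rw [div_le_one (by positivity)]; exact_mod_cast Nat.lt_two_pow_self.le⟩
  have h1 := hiter m r hr hrY
  change ∑ i, f i • x i ∈ _
  rw [heq]
  have h2 : (1 / 2 : ℝ) • h ∈ (1 / 2 : ℝ) • K := ⟨h, hh, rfl⟩
  refine hKs.smul_mono hK0 (by norm_num) (by norm_num : (1 / 2 + 1 : ℝ) ≤ 2)
    (hKs.add_mem_smul (by norm_num) (by norm_num) h2
      (hKs.smul_mem_smul hK0 (t := 1 / 2) ?_ (by positivity) h1))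
  rw [abs_of_pos (by norm_num)]
  linarith

end SymmConvex

/-! ### Bounded coordinates and approximation inside the span. -/

section Widths

/-- A bounded family spanning a finite-dimensional normed space contains a basis with respect to
which all members of the family have coordinates of absolute value at most `2`. -/
lemma exists_bounded_coordinates {V : Type*} [NormedAddCommGroup V] [NormedSpace ℝ V]
    [FiniteDimensional ℝ V] {S : Type*} {a : S → V} {C : ℝ} (hC : ∀ s, ‖a s‖ ≤ C)
    (hspan : Submodule.span ℝ (Set.range a) = ⊤) :
    ∃ n ≤ Module.finrank ℝ V, ∃ s : Fin n → S, ∀ x, ∃ t : Fin n → ℝ,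
      (∀ i, |t i| ≤ 2) ∧ a x = ∑ i, t i • a (s i) := by
  classical
  obtain ⟨f, hf, hfspan, hfli⟩ := Submodule.exists_fun_fin_finrank_span_eq ℝ (Set.range a)
  have hn : Module.finrank ℝ (Submodule.span ℝ (Set.range a)) ≤ Module.finrank ℝ V :=
    Submodule.finrank_le _
  generalize Module.finrank ℝ (Submodule.span ℝ (Set.range a)) = n at f hf hfspan hfli hn
  refine ⟨n, hn, ?_⟩
  let b := Module.Basis.mk hfli (by rw [hfspan, hspan])
  obtain ⟨M, hM⟩ : ∃ M : ℝ, ∀ i x, |b.repr (a x) i| ≤ M := by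
    refine ⟨‖(b.equivFunL : V →L[ℝ] (Fin n → ℝ))‖ * C, fun i x => ?_⟩
    calc |b.repr (a x) i| = ‖(b.equivFunL : V →L[ℝ] (Fin n → ℝ)) (a x) i‖ := by
          simp [Module.Basis.equivFunL]
      _ ≤ ‖(b.equivFunL : V →L[ℝ] (Fin n → ℝ)) (a x)‖ := norm_le_pi_norm _ _
      _ ≤ _ := (ContinuousLinearMap.le_opNorm _ _).trans (by gcongr; exact hC x)
  set D : Set ℝ := Set.range fun s : Fin n → S => |b.det (a ∘ s)| with hD
  have hbdd : BddAbove D := by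
    refine ⟨n.factorial • M ^ n, ?_⟩
    rintro _ ⟨s, rfl⟩
    have := Matrix.det_le (A := b.toMatrix (a ∘ s)) (abv := AbsoluteValue.abs) (x := M)
      (fun i j => hM i (s j))
    simpa [Module.Basis.det_apply] using this
  choose s₀ hs₀ using hf
  have h1 : (1 : ℝ) ∈ D := by
    refine ⟨s₀, ?_⟩
    have : a ∘ s₀ = b := by
      ext i
      simp [b, hs₀]
    simp [this, Module.Basis.det_self]
  have hsup : 1 ≤ sSup D := le_csSup hbdd h1
  -- The supremum of the determinants need not be attained. A choice exceeding half of it bounds the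
  -- coordinates by `2`, since by Cramer's rule they are quotients of determinants.
  obtain ⟨_, ⟨s, rfl⟩, hs⟩ := exists_lt_of_lt_csSup ⟨1, h1⟩ (by linarith : sSup D / 2 < sSup D)
  dsimp only at hs
  have hdet : b.det (a ∘ s) ≠ 0 := by
    intro h
    rw [h, abs_zero] at hs
    linarith
  obtain ⟨hli, hsp⟩ := b.is_basis_iff_det.2 hdet.isUnit
  let e := Module.Basis.mk hli hsp.ge
  refine ⟨s, fun x => ⟨fun i => e.repr (a x) i, fun i => ?_, ?_⟩⟩
  · have h2 := LinearMap.congr_fun (b.det_smul_mk_coord_eq_det_update hli hsp.ge i) (a x)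
    have h3 : b.det (a ∘ s) * e.repr (a x) i = b.det (a ∘ Function.update s i x) := by
      rw [Function.comp_update]
      exact h2
    have h4 : |b.det (a ∘ s)| * |e.repr (a x) i| ≤ sSup D := by
      rw [← abs_mul, h3]
      exact le_csSup hbdd ⟨_, rfl⟩
    by_contra! h5
    have h6 : 0 < |b.det (a ∘ s)| := abs_pos.2 hdet
    nlinarith
  · conv_lhs => rw [← e.sum_repr (a x)]
    simp [e]

/-- The normed case applied to the separation quotient; the expansion then holds only up to a vector
of seminorm zero. -/
lemma exists_bounded_coordinates_of_seminorm {V : Type*} [AddCommGroup V] [Module ℝ V]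
    [FiniteDimensional ℝ V] (p : Seminorm ℝ V) {S : Type*} {a : S → V} {C : ℝ}
    (hC : ∀ s, p (a s) ≤ C) (hspan : Submodule.span ℝ (Set.range a) = ⊤) :
    ∃ n ≤ Module.finrank ℝ V, ∃ s : Fin n → S, ∀ x, ∃ t : Fin n → ℝ,
      (∀ i, |t i| ≤ 2) ∧ p (a x - ∑ i, t i • a (s i)) = 0 := by
  let : SeminormedAddCommGroup V := p.toAddGroupSeminorm.toSeminormedAddCommGroup
  let : NormedSpace ℝ V := { norm_smul_le := fun r x => (map_smul_eq_mul p r x).le }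
  let π : V →ₗ[ℝ] SeparationQuotient V := (SeparationQuotient.mkCLM ℝ V).toLinearMap
  have hπ : Function.Surjective π := SeparationQuotient.surjective_mk
  have : FiniteDimensional ℝ (SeparationQuotient V) := Module.Finite.of_surjective π hπ
  obtain ⟨n, hn, s, hs⟩ := exists_bounded_coordinates (a := fun x => π (a x)) (C := C)
    (fun x => (SeparationQuotient.norm_mk (a x)).trans_le (hC x))
    (by
      rw [show (fun x => π (a x)) = π ∘ a from rfl, Set.range_comp, Submodule.span_image, hspan,
        Submodule.map_top, LinearMap.range_eq_top.2 hπ])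
  refine ⟨n, hn.trans (LinearMap.finrank_le_finrank_of_surjective hπ), s, fun x => ?_⟩
  obtain ⟨t, ht, hx⟩ := hs x
  refine ⟨t, ht, ?_⟩
  have h1 : π (a x - ∑ i, t i • a (s i)) = 0 := by
    rw [map_sub, hx, map_sum]
    simp
  calc p (a x - ∑ i, t i • a (s i)) = ‖π (a x - ∑ i, t i • a (s i))‖ :=
        (SeparationQuotient.norm_mk (a x - ∑ i, t i • a (s i))).symm
    _ = 0 := by rw [h1, norm_zero]

variable {E : Type*} [AddCommGroup E] [Module ℝ E] {X Y : Set E}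

lemma IsSymmConvex.absorbent_of_span (hY : IsSymmConvex Y) (h0 : (0 : E) ∈ Y) {S : Set E}
    (hS : Submodule.span ℝ S = ⊤) (hSY : ∀ x ∈ S, ∃ r : ℝ, 0 ≤ r ∧ x ∈ r • Y) :
    Absorbent ℝ Y := by
  have key : ∀ x : E, ∃ r : ℝ, 0 ≤ r ∧ x ∈ r • Y := by
    intro x
    have hx : x ∈ Submodule.span ℝ S := hS ▸ Submodule.mem_top
    induction hx using Submodule.span_induction with
    | mem x hx => exact hSY x hx
    | zero => exact ⟨0, le_rfl, IsSymmConvex.zero_mem_smul h0 0⟩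
    | add x y _ _ hx hy =>
      obtain ⟨r, hr, hx⟩ := hx
      obtain ⟨s, hs, hy⟩ := hy
      exact ⟨r + s, add_nonneg hr hs, hY.add_mem_smul hr hs hx hy⟩
    | smul c x _ hx =>
      obtain ⟨r, hr, hx⟩ := hx
      exact ⟨|c| * r, mul_nonneg (abs_nonneg _) hr, hY.smul_mem_smul h0 le_rfl hr hx⟩
  intro x
  obtain ⟨r, hr, hx⟩ := key x
  rw [absorbs_iff_norm]
  refine ⟨r, fun c hc => ?_⟩
  rw [Set.singleton_subset_iff]
  have h1 : x ∈ |c| • Y := hY.smul_mono h0 hr hc hx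
  rcases abs_cases c with ⟨h, _⟩ | ⟨h, _⟩ <;> rw [h] at h1
  · exact h1
  · rw [Set.mem_smul_set] at h1 ⊢
    obtain ⟨y, hy, rfl⟩ := h1
    exact ⟨-y, hY.neg_mem hy, by simp⟩

/-- Approximation of `S` by finite-dimensional subspaces can be done within the span of `S`. -/
theorem ApproxBy.inter_span {S : Set E} (hY : IsSymmConvex Y) (h0 : (0 : E) ∈ Y) {k : ℕ}
    {δ C : ℝ} (hδ : 0 < δ) (hC : 0 ≤ C) (hSC : S ⊆ C • Y) (h : ApproxBy k δ S Y) :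
    ApproxBy k (3 * k * δ) S (Y ∩ Submodule.span ℝ S) := by
  obtain ⟨L, hL, hSL⟩ := h
  choose y hy l hl hyl using fun s : S => hSL s.2
  have hLfin : FiniteDimensional ℝ L :=
    Module.rank_lt_aleph0_iff.1 (hL.trans Cardinal.natCast_lt_aleph0)
  let V := Submodule.span ℝ (Set.range l)
  have hVL : V ≤ L := Submodule.span_le.2 (Set.range_subset_iff.2 hl)
  have : FiniteDimensional ℝ V := Submodule.finiteDimensional_of_le hVL
  let a : S → V := fun s => ⟨l s, Submodule.subset_span ⟨s, rfl⟩⟩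
  have ha : Submodule.span ℝ (Set.range a) = ⊤ := by
    apply Submodule.map_injective_of_injective V.injective_subtype
    rw [Submodule.map_span, ← Set.range_comp, Submodule.map_top, Submodule.range_subtype]
    rfl
  let Z : Set V := {v | (v : E) ∈ Y}
  have hZs : IsSymmConvex Z := by
    refine ⟨?_, hY.2.linear_preimage V.subtype⟩
    ext v
    exact ⟨fun h => by simpa [Z] using hY.neg_mem h, fun h => by simpa [Z] using hY.neg_mem h⟩
  have hZsmul : ∀ (r : ℝ) (v : V), (v : E) ∈ r • Y → r ≠ 0 → v ∈ r • Z := by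
    intro r v hv hr
    rw [Set.mem_smul_set_iff_inv_smul_mem₀ hr] at hv ⊢
    simpa [Z] using hv
  -- Boundedness is all that is needed here: `C` does not enter the final constant.
  have hlY : ∀ s, l s ∈ (C + δ) • Y := by
    intro s
    have h1 : l s = s - y s := by
      rw [← hyl s]
      simp
    rw [h1]
    exact hY.sub_mem_smul hC hδ.le (hSC s.2) (hy s)
  have hCδ : 0 < C + δ := by linarith
  have hZabs : Absorbent ℝ Z := hZs.absorbent_of_span h0 ha (by
    rintro _ ⟨s, rfl⟩
    exact ⟨C + δ, hCδ.le, hZsmul _ _ (hlY s) hCδ.ne'⟩)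
  have hZbal : Balanced ℝ Z := by
    intro r hr
    rintro _ ⟨v, hv, rfl⟩
    have := hZs.smul_mem_smul (h0 : (0 : V) ∈ Z) (a := 1) (b := 1) (t := r) (by simpa using hr)
      zero_le_one (by simpa using hv)
    simpa using this
  let p := gaugeSeminorm hZbal hZs.2 hZabs
  obtain ⟨n, hn, s, hs⟩ := exists_bounded_coordinates_of_seminorm p (a := a) (C := C + δ)
    (fun s => gauge_le_of_mem hCδ.le (hZsmul _ _ (hlY s) hCδ.ne')) ha
  have hnk : n + 1 ≤ k := by
    have h1 : (Module.finrank ℝ V : Cardinal) < k := by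
      rw [Module.finrank_eq_rank]
      exact (Submodule.rank_mono hVL).trans_lt hL
    have h2 : Module.finrank ℝ V < k := by exact_mod_cast h1
    omega
  -- The new subspace is spanned by the points `s i` of `S` themselves, not by their components in
  -- `L`.
  refine ⟨Submodule.span ℝ (Set.range fun i => (s i : E)), ?_, fun x hx => ?_⟩
  · refine (rank_span_le _).trans_lt (lt_of_le_of_lt (b := (n : Cardinal)) ?_ (by exact_mod_cast hnk))
    have := Cardinal.mk_range_le_lift (f := fun i => (s i : E))
    simpa using this
  · obtain ⟨t, ht, hp⟩ := hs ⟨x, hx⟩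
    have hLx : ∑ i, t i • (s i : E) ∈ Submodule.span ℝ (Set.range fun i => (s i : E)) :=
      Submodule.sum_mem _ fun i _ => Submodule.smul_mem _ _ (Submodule.subset_span ⟨i, rfl⟩)
    have hLS : Submodule.span ℝ (Set.range fun i => (s i : E)) ≤ Submodule.span ℝ S :=
      Submodule.span_mono (Set.range_subset_iff.2 fun i => (s i).2)
    have hk : (0 : ℝ) < 3 * k * δ := by
      have : (0 : ℝ) < k := by exact_mod_cast (Nat.succ_pos n).trans_le hnk
      positivity
    refine Set.mem_add.2 ⟨x - ∑ i, t i • (s i : E), ?_, _, hLx, sub_add_cancel _ _⟩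
    have hmem : x - ∑ i, t i • (s i : E) ∈ (3 * k * δ) • Y := by
      -- A vector of gauge zero need not vanish, but it lies in `δ • Z` since `0 < δ`.
      have h1 : a ⟨x, hx⟩ - ∑ i, t i • a (s i) ∈ δ • Z := by
        obtain ⟨r, hr0, hr, hmem⟩ := exists_lt_of_gauge_lt hZabs
          (show gauge Z (a ⟨x, hx⟩ - ∑ i, t i • a (s i)) < δ from hp.trans_lt hδ)
        exact hZs.smul_mono h0 hr0.le hr.le hmem
      have h2 : l ⟨x, hx⟩ - ∑ i, t i • l (s i) ∈ δ • Y := by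
        obtain ⟨v, hv, hv'⟩ := h1
        refine ⟨v, hv, ?_⟩
        have := congrArg V.subtype hv'
        simpa [a] using this
      have h3 : ∑ i, t i • y (s i) ∈ (∑ _i : Fin n, 2 * δ) • Y :=
        hY.sum_mem_smul h0 _ (fun _ _ => by positivity) fun i _ =>
          hY.smul_mem_smul h0 (mul_le_mul_of_nonneg_right (ht i) hδ.le) hδ.le (hy _)
      have h4 : x - ∑ i, t i • (s i : E) =
          y ⟨x, hx⟩ - ∑ i, t i • y (s i) + (l ⟨x, hx⟩ - ∑ i, t i • l (s i)) := by
        have h5 : ∀ i, t i • (s i : E) = t i • y (s i) + t i • l (s i) := fun i => by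
          rw [← smul_add]
          exact congrArg _ (hyl _).symm
        have h6 : x = y ⟨x, hx⟩ + l ⟨x, hx⟩ := (hyl ⟨x, hx⟩).symm
        simp only [h5, Finset.sum_add_distrib]
        nth_rewrite 1 [h6]
        abel
      have hpos : 0 ≤ ∑ _i : Fin n, 2 * δ := Finset.sum_nonneg fun _ _ => by positivity
      -- The errors add up to `δ + 2 n δ + δ`, which is at most `3 k δ` because `n + 1 ≤ k`.
      rw [h4]
      refine hY.smul_mono h0 (by positivity) ?_ (hY.add_mem_smul (by positivity) hδ.le
        (hY.sub_mem_smul hδ.le hpos (hy _) h3) h2)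
      have h7 : ((n : ℝ) + 1) ≤ k := by exact_mod_cast hnk
      simp only [Finset.sum_const, Finset.card_univ, Fintype.card_fin, nsmul_eq_mul]
      nlinarith [Nat.cast_nonneg (α := ℝ) n]
    have hspan : x - ∑ i, t i • (s i : E) ∈ Submodule.span ℝ S :=
      sub_mem (Submodule.subset_span hx) (hLS hLx)
    rw [Set.mem_smul_set_iff_inv_smul_mem₀ hk.ne'] at hmem ⊢
    exact ⟨hmem, Submodule.smul_mem _ _ hspan⟩

end Widths

/-! ### Linearizing functions that are additive modulo the integers. -/

section Linearization

variable {E : Type*} [AddCommGroup E] [Module ℝ E] {Y T : Set E}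

/-- Approximate divisibility by two of the generated subgroup, obtained by rounding half of the
integer coefficients. -/
lemma RoundsInto.exists_half (hT : RoundsInto T Y) {h : E} (hh : h ∈ AddSubgroup.closure T) :
    ∃ r ∈ AddSubgroup.closure T, (1 / 2 : ℝ) • h - r ∈ Y := by
  have : ∃ (n : ℕ) (x : Fin n → E), (∀ i, x i ∈ T) ∧ ∃ z : Fin n → ℤ,
      h = ∑ i, (z i : ℝ) • x i := by
    rw [← Submodule.span_int_eq_addSubgroupClosure, Submodule.mem_toAddSubgroup,
      Submodule.mem_span_set'] at hh
    obtain ⟨n, z, x, rfl⟩ := hh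
    exact ⟨n, fun i => x i, fun i => (x i).2, z, by simp only [Int.cast_smul_eq_zsmul]⟩
  obtain ⟨n, x, hx, z, rfl⟩ := this
  obtain ⟨w, -, hw⟩ := hT n x hx fun i => z i / 2
  refine ⟨_, sum_intCast_smul_mem_closure hx w, ?_⟩
  convert hw using 1
  rw [Finset.smul_sum, ← Finset.sum_sub_distrib]
  refine Finset.sum_congr rfl fun i _ => ?_
  rw [smul_smul, ← sub_smul]
  congr 1
  ring

lemma mem_half_smul_of_add_self_mem {x : E} (h : x + x ∈ Y) :
    x ∈ (1 / 2 : ℝ) • Y := by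
  refine ⟨x + x, h, ?_⟩
  simp only [← two_smul ℝ x, smul_smul]
  norm_num

/-- A function which is additive modulo the integers on a subgroup and small on the points of `Y`
in it agrees, on a set `T` which rounds into `Y / 8`, with a linear functional which is small on the
points of `Y / 16` in the span of `T`. -/
theorem exists_linear_of_additive_mod_int (hY : IsSymmConvex Y) (h0 : (0 : E) ∈ Y)
    {H : AddSubgroup E} {θ : E → ℝ}
    (hadd : ∀ x ∈ H, ∀ y ∈ H, ∃ z : ℤ, θ (x + y) = θ x + θ y + z)
    (hθ : ∀ x ∈ H, x ∈ Y → |θ x| ≤ 1 / 4) (hTH : T ⊆ H) (hTY : T ⊆ (1 / 2 : ℝ) • Y)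
    (hT : RoundsInto T ((1 / 8 : ℝ) • Y)) :
    ∃ g : E →ₗ[ℝ] ℝ, (∀ x ∈ T, g x = θ x) ∧
      ∀ x ∈ (1 / 16 : ℝ) • Y, x ∈ Submodule.span ℝ T → |g x| ≤ 1 / 4 := by
  set H' := AddSubgroup.closure T with hH'
  have hH'H : H' ≤ H := (AddSubgroup.closure_le _).2 hTH
  -- The integer defect is at most `3/4` in absolute value, hence zero.
  have hadd' : ∀ x ∈ H', ∀ y ∈ H', x ∈ Y → y ∈ Y → x + y ∈ Y → θ (x + y) = θ x + θ y := by
    intro x hx y hy hxY hyY hxyY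
    obtain ⟨z, hz⟩ := hadd x (hH'H hx) y (hH'H hy)
    have h1 := abs_le.1 (hθ x (hH'H hx) hxY)
    have h2 := abs_le.1 (hθ y (hH'H hy) hyY)
    have h3 := abs_le.1 (hθ _ (hH'H (add_mem hx hy)) hxyY)
    have h4 : (z : ℝ) < 1 := by linarith
    have h5 : (-1 : ℝ) < z := by linarith
    have h6 : z = 0 := by
      have h4' : z < 1 := by exact_mod_cast h4
      have h5' : -1 < z := by exact_mod_cast h5
      omega
    simpa [h6] using hz
  have hθ0 : θ 0 = 0 := by
    have := hadd' 0 (zero_mem _) 0 (zero_mem _) h0 h0 (by simpa using h0)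
    rw [add_zero] at this
    linarith
  have hθneg : ∀ x ∈ H', x ∈ Y → θ (-x) = -θ x := by
    intro x hx hxY
    have := hadd' x hx (-x) (neg_mem hx) hxY (hY.neg_mem hxY) (by simpa using h0)
    rw [add_neg_cancel, hθ0] at this
    linarith
  have hsubY : ∀ {a : ℝ} {x : E}, 0 ≤ a → a ≤ 1 → x ∈ a • Y → x ∈ Y := by
    intro a x h1 h2 hx
    simpa using hY.smul_mono h0 h1 h2 hx
  -- halving up to a small error
  have hhalf : ∀ h : E, ∃ r : E, (h ∈ H' → r ∈ H' ∧ h - (r + r) ∈ (1 / 4 : ℝ) • Y) ∧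
      (h = 0 → r = 0) := by
    intro h
    by_cases h1 : h = 0
    · exact ⟨0, fun _ => ⟨zero_mem _, by simpa [h1] using IsSymmConvex.zero_mem_smul h0 _⟩,
        fun _ => rfl⟩
    by_cases h2 : h ∈ H'
    · obtain ⟨r, hr, hr'⟩ := hT.exists_half h2
      refine ⟨r, fun _ => ⟨hr, ?_⟩, fun h => absurd h h1⟩
      have h3 : h - (r + r) = (2 : ℝ) • ((1 / 2 : ℝ) • h - r) := by
        rw [smul_sub, smul_smul, two_smul]
        norm_num
      rw [h3]
      exact hY.smul_mem_smul h0 (by norm_num) (by norm_num) hr'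
    · exact ⟨0, fun h => absurd h h2, fun _ => rfl⟩
  choose ρ hρ hρ0 using hhalf
  have hρ0 : ρ 0 = 0 := hρ0 0 rfl
  set d : E → E := fun h => h - (ρ h + ρ h) with hd
  have hdH : ∀ h ∈ H', d h ∈ H' := fun h hh =>
    sub_mem hh (add_mem (hρ h hh).1 (hρ h hh).1)
  have hdY : ∀ h ∈ H', d h ∈ (1 / 4 : ℝ) • Y := fun h hh => (hρ h hh).2
  -- The candidate for the graph of an additive real lift of `θ` on `H'`. What has to be shown is
  -- that it is single-valued.
  set Γ : AddSubgroup (E × ℝ) :=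
    AddSubgroup.closure ((fun x => (x, θ x)) '' {x | x ∈ H' ∧ x ∈ (1 / 2 : ℝ) • Y}) with hΓ
  have hΓmem : ∀ x ∈ H', x ∈ (1 / 2 : ℝ) • Y → (x, θ x) ∈ Γ := fun x hx hxY =>
    AddSubgroup.subset_closure ⟨x, ⟨hx, hxY⟩, rfl⟩
  have hΓH : ∀ p ∈ Γ, p.1 ∈ H' ∧ ∃ z : ℤ, p.2 = θ p.1 + z := by
    intro p hp
    induction hp using AddSubgroup.closure_induction with
    | mem p hp =>
      obtain ⟨x, hx, rfl⟩ := hp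
      exact ⟨hx.1, 0, by simp⟩
    | zero => exact ⟨zero_mem _, 0, by simp [hθ0]⟩
    | add p q _ _ hp hq =>
      obtain ⟨hp, z, hz⟩ := hp
      obtain ⟨hq, w, hw⟩ := hq
      obtain ⟨v, hv⟩ := hadd _ (hH'H hp) _ (hH'H hq)
      refine ⟨add_mem hp hq, z + w - v, ?_⟩
      rw [Prod.fst_add, Prod.snd_add, hz, hw, hv]
      push_cast
      ring
    | neg p _ hp =>
      obtain ⟨hp, z, hz⟩ := hp
      obtain ⟨v, hv⟩ := hadd _ (hH'H hp) _ (hH'H (neg_mem hp))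
      refine ⟨neg_mem hp, v - z, ?_⟩
      rw [add_neg_cancel, hθ0] at hv
      rw [Prod.fst_neg, Prod.snd_neg, hz]
      push_cast
      linarith
  -- a point of `H'` whose double is a small combination lies in the graph
  have hΓhalf : ∀ x ∈ H', x + x ∈ Y → (x, θ (x + x) / 2) ∈ Γ := by
    intro x hx hxx
    have h1 := mem_half_smul_of_add_self_mem hxx
    have h2 : x ∈ Y := hsubY (by norm_num) (by norm_num) h1
    rw [hadd' x hx x hx h2 h2 hxx]
    convert hΓmem x hx h1 using 2
    ring
  -- Since `h = 2 ρ h + d h`, the second entry is the value an additive lift would have to take at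
  -- `ρ p.1`.
  have hΓρ : ∀ p ∈ Γ, (ρ p.1, (p.2 - θ (d p.1)) / 2) ∈ Γ := by
    intro p hp
    induction hp using AddSubgroup.closure_induction with
    | mem p hp =>
      obtain ⟨x, ⟨hx, hxY⟩, rfl⟩ := hp
      have h1 : ρ x + ρ x = x + -d x := by
        simp only [hd]
        abel
      have h2 : x + -d x ∈ Y := hsubY (by norm_num) (by norm_num : (1 / 2 + 1 / 4 : ℝ) ≤ 1)
        (hY.add_mem_smul (by norm_num) (by norm_num) hxY (hY.neg_mem_smul (hdY x hx)))
      have h3 := hΓhalf (ρ x) (hρ x hx).1 (h1 ▸ h2)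
      have hdY' := hsubY (by norm_num) (by norm_num) (hdY x hx)
      rwa [h1, hadd' x hx _ (neg_mem (hdH x hx)) (hsubY (by norm_num) (by norm_num) hxY)
        (hY.neg_mem hdY') h2, hθneg _ (hdH x hx) hdY', ← sub_eq_add_neg] at h3
    | zero =>
      convert zero_mem Γ using 1
      simp [hρ0, hd, hθ0]
    | add p q hp hq ihp ihq =>
      have hpH := (hΓH p hp).1
      have hqH := (hΓH q hq).1
      -- The failure of `ρ` to be additive is small: twice it is a sum of three terms `± d`, so it
      -- lies in `3/4 • Y`, where `θ` is additive.
      set x := ρ (p.1 + q.1) - ρ p.1 - ρ q.1 with hx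
      have hxH : x ∈ H' :=
        sub_mem (sub_mem (hρ _ (add_mem hpH hqH)).1 (hρ _ hpH).1) (hρ _ hqH).1
      have h1 : x + x = (d p.1 + d q.1) + -d (p.1 + q.1) := by
        simp only [hd, hx]
        abel
      have h2 : d p.1 + d q.1 ∈ (1 / 4 + 1 / 4 : ℝ) • Y :=
        hY.add_mem_smul (by norm_num) (by norm_num) (hdY _ hpH) (hdY _ hqH)
      have h3 : (d p.1 + d q.1) + -d (p.1 + q.1) ∈ Y :=
        hsubY (by norm_num) (by norm_num : (1 / 4 + 1 / 4 + 1 / 4 : ℝ) ≤ 1)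
          (hY.add_mem_smul (by norm_num) (by norm_num) h2
            (hY.neg_mem_smul (hdY _ (add_mem hpH hqH))))
      have hdY' : ∀ h ∈ H', d h ∈ Y := fun h hh => hsubY (by norm_num) (by norm_num) (hdY h hh)
      have h4 := hΓhalf x hxH (h1 ▸ h3)
      rw [h1, hadd' _ (add_mem (hdH _ hpH) (hdH _ hqH)) _ (neg_mem (hdH _ (add_mem hpH hqH)))
        (hsubY (by norm_num) (by norm_num) h2) (hY.neg_mem (hdY' _ (add_mem hpH hqH))) h3,
        hadd' _ (hdH _ hpH) _ (hdH _ hqH) (hdY' _ hpH) (hdY' _ hqH)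
          (hsubY (by norm_num) (by norm_num) h2),
        hθneg _ (hdH _ (add_mem hpH hqH)) (hdY' _ (add_mem hpH hqH))] at h4
      convert add_mem (add_mem ihp ihq) h4 using 1
      ext
      · simp [hx]
      · simp only [Prod.fst_add, Prod.snd_add]
        ring
    | neg p hp ih =>
      have hpH := (hΓH p hp).1
      set x := ρ (-p.1) + ρ p.1 with hx
      have hxH : x ∈ H' := add_mem (hρ _ (neg_mem hpH)).1 (hρ _ hpH).1
      have h1 : x + x = -(d p.1 + d (-p.1)) := by
        simp only [hd, hx]
        abel
      have h2 : d p.1 + d (-p.1) ∈ Y :=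
        hsubY (by norm_num) (by norm_num : (1 / 4 + 1 / 4 : ℝ) ≤ 1)
          (hY.add_mem_smul (by norm_num) (by norm_num) (hdY _ hpH) (hdY _ (neg_mem hpH)))
      have hdY' : ∀ h ∈ H', d h ∈ Y := fun h hh => hsubY (by norm_num) (by norm_num) (hdY h hh)
      have h4 := hΓhalf x hxH (h1 ▸ hY.neg_mem h2)
      rw [h1, hθneg _ (add_mem (hdH _ hpH) (hdH _ (neg_mem hpH))) h2,
        hadd' _ (hdH _ hpH) _ (hdH _ (neg_mem hpH)) (hdY' _ hpH) (hdY' _ (neg_mem hpH)) h2] at h4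
      convert add_mem (neg_mem ih) h4 using 1
      ext
      · simp [hx]
      · simp only [Prod.fst_neg, Prod.snd_neg, Prod.snd_add, Prod.neg_mk]
        ring
  -- Halving keeps the first entry `0`, so every `s / 2 ^ n` occurs over `0`. All such values are
  -- integers, which forces `s = 0`.
  have hΓzero : ∀ s : ℝ, ((0 : E), s) ∈ Γ → s = 0 := by
    intro s hs
    have h1 : ∀ n : ℕ, ((0 : E), s / 2 ^ n) ∈ Γ := by
      intro n
      induction n with
      | zero => simpa using hs
      | succ n ih =>
        have := hΓρ _ ih
        simp only [hρ0, hd, add_zero, sub_zero, hθ0] at this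
        rwa [pow_succ, ← div_div]
    obtain ⟨n, hn⟩ := pow_unbounded_of_one_lt |s| one_lt_two
    obtain ⟨-, z, hz⟩ := hΓH _ (h1 n)
    simp only [hθ0, zero_add] at hz
    have h2 : |(z : ℝ)| < 1 := by
      rw [← hz, abs_div, abs_of_pos (by positivity : (0 : ℝ) < 2 ^ n), div_lt_one (by positivity)]
      exact hn
    have h3 : z = 0 := by
      rw [← Int.cast_abs] at h2
      exact Int.abs_lt_one_iff.1 (by exact_mod_cast h2)
    rw [h3] at hz
    simpa using hz
  have hΓuniq : ∀ x s, (x, s) ∈ Γ → x ∈ (1 / 2 : ℝ) • Y → s = θ x := by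
    intro x s hs hx
    have h1 := sub_mem hs (hΓmem x (hΓH _ hs).1 hx)
    rw [Prod.mk_sub_mk, sub_self] at h1
    linarith [hΓzero _ h1]
  -- real linear relations are respected
  have hrel : ∀ (n : ℕ) (x : Fin n → E), (∀ i, x i ∈ T) → ∀ t : Fin n → ℝ,
      ∑ i, t i • x i = 0 → ∑ i, t i * θ (x i) = 0 := by
    intro n x hx t ht
    -- Rounding `M t` changes the `θ`-sum by at most `n`, and the rounded combination is small, so
    -- its `θ`-sum is at most `1/4`. As `M` is arbitrary, the sum for `t` must vanish.
    have hbound : ∀ M : ℕ, M * |∑ i, t i * θ (x i)| ≤ n + 1 := by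
      intro M
      obtain ⟨z, hz, hmem⟩ := hT n x hx fun i => M * t i
      have h1 : ∑ i, (z i : ℝ) • x i = -∑ i, (M * t i - z i) • x i := by
        simp only [sub_smul, mul_smul, Finset.sum_sub_distrib, ← Finset.smul_sum, ht]
        simp
      have h2 : ∑ i, (z i : ℝ) • x i ∈ (1 / 2 : ℝ) • Y := by
        rw [h1]
        exact hY.smul_mono h0 (by norm_num) (by norm_num) (hY.neg_mem_smul hmem)
      have h3 : (∑ i, (z i : ℝ) • x i, ∑ i, (z i : ℝ) * θ (x i)) ∈ Γ := by
        have : (∑ i, (z i : ℝ) • x i, ∑ i, (z i : ℝ) * θ (x i)) =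
            ∑ i, z i • ((x i, θ (x i)) : E × ℝ) := by
          ext <;> simp [Prod.fst_sum, Prod.snd_sum, Int.cast_smul_eq_zsmul]
        rw [this]
        exact sum_mem fun i _ => zsmul_mem
          (hΓmem _ (AddSubgroup.subset_closure (hx i)) (hTY (hx i))) _
      have h4 : |∑ i, (z i : ℝ) * θ (x i)| ≤ 1 / 4 := by
        rw [hΓuniq _ _ h3 h2]
        exact hθ _ (hH'H (hΓH _ h3).1) (hsubY (by norm_num) (by norm_num) h2)
      have h5 : |∑ i, (M * t i - z i) * θ (x i)| ≤ n := by
        refine (Finset.abs_sum_le_sum_abs _ _).trans ?_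
        refine (Finset.sum_le_sum (g := fun _ => (1 : ℝ)) fun i _ => ?_).trans_eq (by simp)
        rw [abs_mul]
        have := hθ _ (hTH (hx i)) (hsubY (by norm_num) (by norm_num) (hTY (hx i)))
        exact mul_le_one₀ (hz i) (abs_nonneg _) (by linarith)
      calc M * |∑ i, t i * θ (x i)|
          = |∑ i, (M * t i - z i) * θ (x i) + ∑ i, (z i : ℝ) * θ (x i)| := by
            rw [← Nat.abs_cast M, ← abs_mul, Finset.mul_sum, ← Finset.sum_add_distrib]
            congr 1
            refine Finset.sum_congr rfl fun i _ => ?_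
            rw [Nat.abs_cast]
            ring
        _ ≤ _ := (abs_add_le _ _).trans (by linarith)
    by_contra h
    obtain ⟨M, hM⟩ := exists_nat_gt ((n + 1 : ℝ) / |∑ i, t i * θ (x i)|)
    rw [div_lt_iff₀ (abs_pos.2 h)] at hM
    exact absurd (hbound M) (not_le.2 hM)
  obtain ⟨g, hg⟩ : ∃ g : E →ₗ[ℝ] ℝ, ∀ x ∈ T, g x = θ x := by
    let A : (T →₀ ℝ) →ₗ[ℝ] E := Finsupp.linearCombination ℝ (fun x : T => (x : E))
    let B : (T →₀ ℝ) →ₗ[ℝ] ℝ := Finsupp.linearCombination ℝ (fun x : T => θ x)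
    have hAB : LinearMap.ker A ≤ LinearMap.ker B := by
      intro c hc
      rw [LinearMap.mem_ker] at hc ⊢
      simp only [A, B, Finsupp.linearCombination_apply, Finsupp.sum] at hc ⊢
      let e := c.support.equivFin.symm
      have h2 := hrel _ (fun i => ((e i : T) : E)) (fun i => (e i : T).2) (fun i => c (e i)) (by
        rw [e.sum_comp fun x => c x • ((x : T) : E),
          Finset.sum_coe_sort c.support fun x => c x • (x : E)]
        exact hc)
      rwa [e.sum_comp fun x => c x * θ (x : T),
        Finset.sum_coe_sort c.support fun x => c x * θ x] at h2
    obtain ⟨g₀, hg₀⟩ := LinearMap.exists_extend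
      ((LinearMap.ker A).liftQ B hAB ∘ₗ A.quotKerEquivRange.symm.toLinearMap)
    refine ⟨g₀, fun x hx => ?_⟩
    let c : T →₀ ℝ := Finsupp.single ⟨x, hx⟩ 1
    have hc : A c = x := by simp [A, c]
    have h1 := LinearMap.congr_fun hg₀ (A.quotKerEquivRange (Submodule.Quotient.mk c))
    simp only [LinearMap.comp_apply, LinearEquiv.coe_coe, LinearEquiv.symm_apply_apply] at h1
    rw [Submodule.subtype_apply, LinearMap.quotKerEquivRange_apply_mk] at h1
    simpa [hc, B, c] using h1
  have hgΓ : ∀ x ∈ H', (x, g x) ∈ Γ := by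
    intro x hx
    induction hx using AddSubgroup.closure_induction with
    | mem x hx =>
      rw [hg x hx]
      exact hΓmem x (AddSubgroup.subset_closure hx) (hTY hx)
    | zero =>
      rw [map_zero]
      exact zero_mem Γ
    | add x y _ _ hx hy => simpa using add_mem hx hy
    | neg x _ hx => simpa using neg_mem hx
  refine ⟨g, hg, fun x hx hxT => ?_⟩
  have hconv : ∀ y ∈ convexHull ℝ ((1 / 2 : ℝ) • Y ∩ (H' : Set E)), |g y| ≤ 1 / 4 := by
    have : convexHull ℝ ((1 / 2 : ℝ) • Y ∩ (H' : Set E)) ⊆ g ⁻¹' Set.Icc (-(1 / 4)) (1 / 4) := by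
      refine convexHull_min ?_ ((convex_Icc _ _).linear_preimage g)
      rintro y ⟨hyY, hy⟩
      rw [Set.mem_preimage, Set.mem_Icc, ← abs_le, hΓuniq y _ (hgΓ y hy) hyY]
      exact hθ y (hH'H hy) (hsubY (by norm_num) (by norm_num) hyY)
    intro y hy
    exact abs_le.2 (this hy)
  -- The hull theorem is used with `Y / 2` in place of `Y`; its factor `2` cancels the doubling of
  -- `x`.
  have h2x : (2 : ℝ) • x ∈ (1 / 4 : ℝ) • (1 / 2 : ℝ) • Y := by
    rw [smul_smul]
    exact hY.smul_mem_smul h0 (by norm_num) (by norm_num) hx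
  obtain ⟨y, hy, hxy⟩ := mem_convexHull_of_roundsInto (hY.smul _)
    (IsSymmConvex.zero_mem_smul h0 _) hTY
    (hT.mono subset_rfl (by rw [smul_smul]; norm_num)) h2x (Submodule.smul_mem _ _ hxT)
  have : y = x := smul_right_injective E (two_ne_zero (α := ℝ)) hxy
  exact this ▸ hconv y hy

end Linearization

/-! ### Approximation between convex hulls of subgroup points. -/

section SubgroupHulls

variable {E : Type*} [AddCommGroup E] [Module ℝ E] {X Y : Set E}

/-- Passing to the convex hulls of the points of a subgroup preserves approximability, up to
polynomial factors. -/
theorem approxBy_convexHull_inter_subgroup (hY : IsSymmConvex Y) (h0 : (0 : E) ∈ Y)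
    {δ : ℕ → ℝ} (hδ0 : ∀ k, 0 ≤ δ k) (hδ : ∀ k, 1 ≤ k → 0 < δ k)
    (hX : ∀ k, 1 ≤ k → ApproxBy k (δ k) X Y)
    (hsum : ∀ n, ∑ k ∈ Finset.range n, ((k + 1 : ℕ) : ℝ) * δ (k + 1) ≤ 1 / 4)
    (H : AddSubgroup E) {k : ℕ} (hk : 1 ≤ k) :
    ApproxBy k (24 * k * δ k) (convexHull ℝ (X ∩ H)) (convexHull ℝ (Y ∩ H)) := by
  set K := convexHull ℝ (Y ∩ (H : Set E)) with hK
  set T := X ∩ (H : Set E) with hT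
  have hT1 : T ⊆ δ 1 • Y := Set.inter_subset_left.trans (hX 1 le_rfl).subset_of_one
  have hδ1 : δ 1 ≤ 1 := by
    have := hsum 1
    simp at this
    linarith
  have hTY : T ⊆ Y := hT1.trans (by simpa using hY.smul_mono h0 (hδ0 1) hδ1)
  have hround : RoundsInto T ((1 / 4 : ℝ) • Y) :=
    (roundsInto_of_approxBy hY h0 hδ0 hX hsum).mono Set.inter_subset_left subset_rfl
  have h1 : ApproxBy k (3 * k * δ k) T (Y ∩ Submodule.span ℝ T) :=
    ((hX k hk).mono_left Set.inter_subset_left).inter_span hY h0 (hδ k hk) (hδ0 1) hT1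
  -- The factor `8` is `4`, from scaling into `Y / 4`, times the `2` of the hull theorem; with `3 k
  -- δ k` it gives `24 k δ k`.
  have h2 : Y ∩ (Submodule.span ℝ T : Set E) ⊆ (8 : ℝ) • K := by
    rintro e ⟨heY, heT⟩
    have h3 := mem_convexHull_of_roundsInto hY h0 hTY hround
      (e := (1 / 4 : ℝ) • e) ⟨e, heY, rfl⟩ (Submodule.smul_mem _ _ heT)
    have h4 : (2 : ℝ) • convexHull ℝ (Y ∩ (AddSubgroup.closure T : Set E)) ⊆ (2 : ℝ) • K :=
      Set.smul_set_mono (convexHull_mono (Set.inter_subset_inter_right _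
        ((AddSubgroup.closure_le H).2 Set.inter_subset_right)))
    obtain ⟨y, hy, hye⟩ := h4 h3
    refine ⟨y, hy, ?_⟩
    have h5 : e = (4 : ℝ) • (1 / 4 : ℝ) • e := by
      rw [smul_smul]
      norm_num
    rw [h5, ← hye]
    simp only [smul_smul]
    norm_num
  obtain ⟨L, hL, h⟩ := h1.mono_right h2
  refine ApproxBy.convexHull ⟨L, hL, ?_⟩ (convex_convexHull ℝ _)
  rw [smul_smul] at h
  convert h using 3
  ring

/-- Comparison with the telescoping series of `2 / (k (k + 1))`. -/
lemma sum_range_mul_div_pow_le {ε : ℝ} (hε : 0 ≤ ε) {m : ℕ} (hm : 3 ≤ m) (n : ℕ) :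
    ∑ k ∈ Finset.range n, ((k + 1 : ℕ) : ℝ) * (ε / ((k + 1 : ℕ) : ℝ) ^ m) ≤ 2 * ε := by
  have h1 : ∀ k : ℕ, ((k + 1 : ℕ) : ℝ) * (ε / ((k + 1 : ℕ) : ℝ) ^ m) ≤
      2 * ε * (1 / ((k : ℝ) + 1) - 1 / (((k + 1 : ℕ) : ℝ) + 1)) := by
    intro k
    have hk : (1 : ℝ) ≤ (k : ℝ) + 1 := by linarith [Nat.cast_nonneg (α := ℝ) k]
    have h2 : ((k : ℝ) + 1) ^ 3 ≤ ((k : ℝ) + 1) ^ m := pow_le_pow_right₀ hk hm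
    push_cast
    calc ((k : ℝ) + 1) * (ε / ((k : ℝ) + 1) ^ m) ≤ ((k : ℝ) + 1) * (ε / ((k : ℝ) + 1) ^ 3) := by
          gcongr
      _ = ε * (1 / ((k : ℝ) + 1) ^ 2) := by field_simp
      _ ≤ ε * (2 / (((k : ℝ) + 1) * ((k : ℝ) + 1 + 1))) := by
          gcongr ?_ * ?_
          rw [div_le_div_iff₀ (by positivity) (by positivity)]
          nlinarith
      _ = _ := by field_simp; ring
  refine (Finset.sum_le_sum fun k _ => h1 k).trans ?_
  rw [← Finset.mul_sum, Finset.sum_range_sub' (fun k : ℕ => 1 / ((k : ℝ) + 1))]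
  have : (0 : ℝ) ≤ 1 / ((n : ℝ) + 1) := by positivity
  nlinarith [mul_nonneg hε this]

end SubgroupHulls

/-! ### Real representatives of points of the circle. -/

section CircleLift

/-- The representative in `(-1/2, 1/2]` of a point of the circle. -/
def circleLift (z : Circle) : ℝ := Complex.arg z / (2 * Real.pi)

lemma exp_circleLift (z : Circle) : Circle.exp (2 * Real.pi * circleLift z) = z := by
  rw [circleLift, mul_div_cancel₀ _ Real.two_pi_pos.ne']
  exact Circle.exp_arg z

lemma abs_circleLift_le (z : Circle) : |circleLift z| ≤ 1 / 2 := by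
  rw [circleLift, abs_div, abs_of_pos Real.two_pi_pos, div_le_iff₀ Real.two_pi_pos]
  have := Complex.abs_arg_le_pi (z : ℂ)
  linarith

lemma abs_circleLift_le_quarter {z : Circle} (hz : z ∈ circlePos) : |circleLift z| ≤ 1 / 4 :=
  abs_le_quarter_of_exp_mem (abs_circleLift_le z) ((exp_circleLift z).symm ▸ hz)

lemma mem_circlePos_of_abs_le {t : ℝ} (ht : |t| ≤ 1 / 4) :
    Circle.exp (2 * Real.pi * t) ∈ circlePos := by
  change 0 ≤ (Complex.exp (((2 * Real.pi * t : ℝ) : ℂ) * Complex.I)).re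
  rw [Complex.exp_ofReal_mul_I_re]
  have h := abs_le.1 ht
  apply Real.cos_nonneg_of_mem_Icc
  constructor <;> nlinarith [Real.pi_pos]

lemma exists_int_of_circleExp_eq {a b : ℝ}
    (h : Circle.exp (2 * Real.pi * a) = Circle.exp (2 * Real.pi * b)) : ∃ z : ℤ, a = b + z := by
  obtain ⟨m, hm⟩ := Circle.exp_eq_exp.1 h
  refine ⟨m, ?_⟩
  have := Real.two_pi_pos
  have h1 : 2 * Real.pi * a = 2 * Real.pi * (b + m) := by rw [hm]; ring
  exact mul_left_cancel₀ this.ne' h1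

lemma eq_of_circleExp_eq {a b : ℝ} (ha : |a| ≤ 1 / 4) (hb : |b| ≤ 1 / 4)
    (h : Circle.exp (2 * Real.pi * a) = Circle.exp (2 * Real.pi * b)) : a = b := by
  obtain ⟨z, hz⟩ := exists_int_of_circleExp_eq h
  have h1 := abs_le.1 ha
  have h2 := abs_le.1 hb
  have h3 : (z : ℝ) < 1 := by linarith
  have h4 : (-1 : ℝ) < z := by linarith
  have h3' : z < 1 := by exact_mod_cast h3
  have h4' : -1 < z := by exact_mod_cast h4
  have h5 : z = 0 := by omega
  simpa [h5] using hz

end CircleLift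

/-! ### From nuclear groups to estimates in `ℝ^{G^∧}`. -/

section Characters

variable {G : Type u} [AddCommGroup G]

/-- The factor `2` replaces the infimum by an actual subspace, and nonemptiness of `A` forces `0 ∈
Y`. -/
lemma exists_approxBy_of_kolmogoroffLE {A B : Set G} (hA : A.Nonempty) {m : ℕ} {c : ℝ}
    (hc : 0 < c) (h : KolmogoroffLE A B fun k => ENNReal.ofReal (c / (k : ℝ) ^ m)) :
    ∃ (E : Type u) (_ : AddCommGroup E) (_ : Module ℝ E) (X Y : Set E)
      (H : AddSubgroup E) (φ : H →+ G), IsSymmConvex Y ∧ (0 : E) ∈ Y ∧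
      (∀ k : ℕ, 1 ≤ k → ApproxBy k (2 * c / (k : ℝ) ^ m) X Y) ∧
      A ⊆ φ '' {h : H | (h : E) ∈ X} ∧ φ '' {h : H | (h : E) ∈ Y} ⊆ B := by
  obtain ⟨E, i1, i2, X, Y, H, φ, -, hY, hd, hA', hB⟩ := h
  have hlt : ∀ k : ℕ, 1 ≤ k →
      kolmogoroffNumber k X Y < ENNReal.ofReal (2 * c / (k : ℝ) ^ m) := by
    intro k hk
    refine (hd k hk).trans_lt ?_
    have hk' : (0 : ℝ) < (k : ℝ) ^ m := pow_pos (by exact_mod_cast hk) m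
    rw [ENNReal.ofReal_lt_ofReal_iff (by positivity)]
    gcongr
    linarith
  have h0 : (0 : E) ∈ Y := by
    obtain ⟨g, hg⟩ := hA
    obtain ⟨x, hx, -⟩ := hA' hg
    obtain ⟨_, ⟨c', hc', rfl, L, -, hXL⟩, -⟩ := sInf_lt_iff.1 (hlt 1 le_rfl)
    obtain ⟨_, ⟨y, hy, -⟩, -⟩ := hXL hx
    exact hY.zero_mem ⟨y, hy⟩
  exact ⟨E, i1, i2, X, Y, H, φ, hY, h0,
    fun k hk => approxBy_of_kolmogoroffNumber_lt hY (hlt k hk) h0, hA', hB⟩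

variable [TopologicalSpace G]

variable (G) in
/-- `H₀` as a subgroup of `ℝ^{G^∧}`. -/
def subgroupH₀ : AddSubgroup (CharGroup G → ℝ) where
  carrier := setH₀ G
  zero_mem' := zero_mem_setH₀
  add_mem' := add_mem_setH₀
  neg_mem' := neg_mem_setH₀

/-- Linearization of a quasi-convex set `U` along a homomorphism defined on a subgroup of a real
vector space: the coordinates indexed by the polar of `U` are given by linear functionals. -/
lemma exists_linear_of_groupPolar {U : Set G} {E : Type*} [AddCommGroup E]
    [Module ℝ E] {X Y : Set E} {H : AddSubgroup E} {φ : H →+ G} (hY : IsSymmConvex Y)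
    (h0 : (0 : E) ∈ Y) (hφ : φ '' {h : H | (h : E) ∈ Y} ⊆ U)
    (hXY : X ⊆ (1 / 2 : ℝ) • Y) (hround : RoundsInto X ((1 / 8 : ℝ) • Y)) :
    ∃ g : E →ₗ[ℝ] (CharGroup G → ℝ),
      (∀ χ ∈ groupPolar U, ∀ h : H, (h : E) ∈ X →
        Circle.exp (2 * Real.pi * g h χ) = χ.eval (φ h) ∧ |g h χ| ≤ 1 / 4) ∧
      ∀ χ ∈ groupPolar U, ∀ x ∈ (1 / 16 : ℝ) • Y, x ∈ Submodule.span ℝ (X ∩ H) →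
        |g x χ| ≤ 1 / 4 := by
  classical
  have key : ∀ χ : CharGroup G, ∃ f : E →ₗ[ℝ] ℝ, χ ∈ groupPolar U →
      (∀ h : H, (h : E) ∈ X → Circle.exp (2 * Real.pi * f h) = χ.eval (φ h) ∧ |f h| ≤ 1 / 4) ∧
      ∀ x ∈ (1 / 16 : ℝ) • Y, x ∈ Submodule.span ℝ (X ∩ H) → |f x| ≤ 1 / 4 := by
    intro χ
    by_cases hχ : χ ∈ groupPolar U
    swap
    · exact ⟨0, fun h => absurd h hχ⟩
    -- The value `0` outside `H` is never used.
    set θ : E → ℝ := fun x => if h : x ∈ H then circleLift (χ.eval (φ ⟨x, h⟩)) else 0 with hθ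
    have hθH : ∀ h : H, θ h = circleLift (χ.eval (φ h)) := fun h => by simp [hθ]
    have hYθ : ∀ x ∈ H, x ∈ Y → |θ x| ≤ 1 / 4 := by
      intro x hx hxY
      rw [hθH ⟨x, hx⟩]
      exact abs_circleLift_le_quarter (hχ _ (hφ ⟨⟨x, hx⟩, hxY, rfl⟩))
    have hXY' : X ⊆ Y := hXY.trans (by
      simpa using hY.smul_mono h0 (by norm_num : (0 : ℝ) ≤ 1 / 2) (by norm_num : (1 / 2 : ℝ) ≤ 1))
    obtain ⟨f, hf, hfY⟩ := exists_linear_of_additive_mod_int (T := X ∩ H) (H := H) (θ := θ) hY h0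
      (fun x hx y hy => by
        have h1 := hθH (⟨x, hx⟩ + ⟨y, hy⟩)
        have h2 := hθH ⟨x, hx⟩
        have h3 := hθH ⟨y, hy⟩
        simp only [AddSubgroup.coe_add] at h1 h2 h3
        apply exists_int_of_circleExp_eq
        rw [h1, h2, h3, mul_add, Circle.exp_add, exp_circleLift, exp_circleLift, exp_circleLift,
          map_add, CharGroup.eval_add])
      hYθ Set.inter_subset_right (Set.inter_subset_left.trans hXY)
      (hround.mono Set.inter_subset_left subset_rfl)
    refine ⟨f, fun _ => ⟨fun h hh => ?_, hfY⟩⟩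
    rw [hf h ⟨hh, h.2⟩]
    exact ⟨by rw [hθH, exp_circleLift], hYθ h h.2 (hXY' hh)⟩
  choose f hf using key
  exact ⟨LinearMap.pi f, fun χ hχ => (hf χ hχ).1, fun χ hχ => (hf χ hχ).2⟩

/-- The core of (i) ⇒ (iii). The widths of `X` in `Y` are transported by linear functionals to `X₀`
and `Y₀`, whose coordinates outside the polar of `U` are free, and then restricted to `H₀`. -/
theorem IsNuclearGroup.exists_approxBy [IsTopologicalAddGroup G] (hG : IsLocallyQuasiConvex G)
    (hnuc : IsNuclearGroup G) {U : Set G} (hU : U ∈ 𝓝 0) (hUq : IsQuasiConvex U) :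
    ∃ W ∈ 𝓝 (0 : G), IsQuasiConvex W ∧ ∀ k : ℕ, 1 ≤ k →
      ApproxBy k (1 / (k : ℝ)) (convexHull ℝ (setX W ∩ setH₀ G))
        (convexHull ℝ (setX U ∩ setH₀ G)) := by
  classical
  -- Passing to the span and later to the hulls over `H₀` costs a factor `k` each; the rounding over
  -- `H₀` in between needs exponent `3`. Hence the exponent `4`.
  obtain ⟨W', hW', hKol⟩ := hnuc.2.2 4 (by norm_num) (1 / 10000) (by norm_num) U hU
  obtain ⟨E, _, _, X, Y, H, φ, hY, h0, hXY, hWX, hYU⟩ :=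
    exists_approxBy_of_kolmogoroffLE ⟨0, mem_of_mem_nhds hW'⟩ (by norm_num) hKol
  obtain ⟨W, hW, hWq, hWsub⟩ := hG (W' ∩ U) (Filter.inter_mem hW' hU)
  set δ : ℕ → ℝ := fun k => 1 / 5000 / (k : ℝ) ^ 4 with hδdef
  have hδ : ∀ k, 1 ≤ k → ApproxBy k (δ k) X Y := by
    intro k hk
    convert hXY k hk using 2
    norm_num
  have hδ0 : ∀ k, 0 ≤ δ k := fun k => by positivity
  have hδpos : ∀ k : ℕ, 1 ≤ k → 0 < δ k := fun k hk => by
    have : (0 : ℝ) < k := by exact_mod_cast hk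
    positivity
  have hδ1 : X ⊆ δ 1 • Y := (hδ 1 le_rfl).subset_of_one
  have hround : RoundsInto X ((1 / 8 : ℝ) • Y) := by
    refine roundsInto_of_approxBy hY h0 hδ0 hδ fun n => ?_
    exact (sum_range_mul_div_pow_le (by norm_num) (by norm_num) n).trans (by norm_num)
  obtain ⟨g, hgX, hgY⟩ := exists_linear_of_groupPolar hY h0 hYU
    (hδ1.trans (hY.smul_mono h0 (hδ0 1) (by norm_num [hδdef]))) hround
  set T := X ∩ (H : Set E) with hT
  set Z : Set E := Y ∩ Submodule.span ℝ T with hZ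
  have hZconv : Convex ℝ Z := hY.2.inter (Submodule.span ℝ T).convex
  set X₀ : Set (CharGroup G → ℝ) :=
    {v | ∃ e ∈ convexHull ℝ T, ∀ χ ∈ groupPolar U, v χ = g e χ} with hX₀
  set Y₀ : Set (CharGroup G → ℝ) := {v | ∀ χ ∈ groupPolar U, |v χ| ≤ 1 / 4} with hY₀
  have hY₀s : IsSymmConvex Y₀ := by
    refine ⟨?_, ?_⟩
    · ext v
      simp [hY₀]
    · intro v hv w hw a b ha hb hab χ hχ
      have h1 := abs_le.1 (hv χ hχ)
      have h2 := abs_le.1 (hw χ hχ)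
      simp only [Pi.add_apply, Pi.smul_apply, smul_eq_mul]
      rw [abs_le]
      constructor <;> nlinarith
  have hY₀0 : (0 : CharGroup G → ℝ) ∈ Y₀ := fun χ _ => by simp
  -- On the polar of `U` both `x` and `g h` lift the same character value with modulus at most
  -- `1/4`, so they agree.
  have hXH : setX W ∩ setH₀ G ⊆ X₀ ∩ subgroupH₀ G := by
    rintro x ⟨⟨a, ha, hx⟩, hxH⟩
    refine ⟨?_, hxH⟩
    obtain ⟨h, hh, rfl⟩ := hWX (hWsub ha).1
    refine ⟨h, subset_convexHull ℝ _ ⟨hh, h.2⟩, fun χ hχ => ?_⟩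
    obtain ⟨h1, h2⟩ := hx χ (groupPolar_anti (fun b hb => (hWsub hb).2) hχ)
    obtain ⟨h3, h4⟩ := hgX χ hχ h hh
    exact eq_of_circleExp_eq h2 h4 (h1.trans h3.symm)
  have hYH : Y₀ ∩ subgroupH₀ G ⊆ setX U ∩ setH₀ G := by
    rintro x ⟨hxY, a, ha⟩
    refine ⟨⟨a, ?_, fun χ hχ => ⟨ha χ, hxY χ hχ⟩⟩, a, ha⟩
    rw [hUq]
    intro χ hχ
    rw [← ha χ]
    exact mem_circlePos_of_abs_le (hxY χ hχ)
  -- The constant is `3 · 16 / 5000`: `3` from passing to the span, `16` because the functionals are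
  -- controlled on `Y / 16`.
  have happrox : ∀ k : ℕ, 1 ≤ k → ApproxBy k (48 / 5000 / (k : ℝ) ^ 3) X₀ Y₀ := by
    intro k hk
    have hkpos : (0 : ℝ) < k := by exact_mod_cast hk
    obtain ⟨L, hL, hTL⟩ := ApproxBy.convexHull (ApproxBy.inter_span hY h0 (hδpos k hk) (hδ0 1)
      (Set.inter_subset_left.trans hδ1) ((hδ k hk).mono_left Set.inter_subset_left : ApproxBy k _ T _))
      hZconv
    refine ⟨L.map g, (rank_map_le g L).trans_lt hL, ?_⟩
    rintro v ⟨e, he, hv⟩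
    obtain ⟨_, ⟨y, hy, rfl⟩, l, hl, rfl⟩ := hTL he
    refine Set.mem_add.2 ⟨v - g l, ?_, g l, ⟨l, hl, rfl⟩, sub_add_cancel _ _⟩
    rw [Set.mem_smul_set_iff_inv_smul_mem₀ (by positivity)]
    intro χ hχ
    have h1 : |g ((1 / 16 : ℝ) • y) χ| ≤ 1 / 4 :=
      hgY χ hχ _ ⟨y, hy.1, rfl⟩ (Submodule.smul_mem _ _ hy.2)
    have h2 : (48 / 5000 / (k : ℝ) ^ 3)⁻¹ * (3 * k * δ k * g y χ) = g ((1 / 16 : ℝ) • y) χ := by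
      simp only [map_smul, Pi.smul_apply, smul_eq_mul, hδdef]
      field_simp
      ring
    simp only [Pi.smul_apply, Pi.sub_apply, hv χ hχ, map_add, map_smul, Pi.add_apply,
      add_sub_cancel_right, smul_eq_mul]
    rwa [h2]
  refine ⟨W, hW, hWq, fun k hk => ?_⟩
  have hkpos : (0 : ℝ) < k := by exact_mod_cast hk
  have hk1 : (1 : ℝ) ≤ k := by exact_mod_cast hk
  have h1 := approxBy_convexHull_inter_subgroup (δ := fun k : ℕ => 48 / 5000 / (k : ℝ) ^ 3)
    hY₀s hY₀0 (fun k => by positivity)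
    (fun k hk => by
      have : (0 : ℝ) < k := by exact_mod_cast hk
      positivity) happrox
    (fun n => (sum_range_mul_div_pow_le (by norm_num) le_rfl n).trans (by norm_num))
    (subgroupH₀ G) hk
  have h2 := (h1.mono_left (convexHull_mono hXH)).mono_right (convexHull_mono hYH)
  refine h2.mono_const (isSymmConvex_convexHull fun x hx =>
    ⟨neg_mem_setX hUq hx.1, neg_mem_setH₀ hx.2⟩) (subset_convexHull ℝ _
      ⟨zero_mem_setX (mem_of_mem_nhds hU), zero_mem_setH₀⟩) (by positivity) ?_
  have h3 : 24 * (k : ℝ) * (48 / 5000 / (k : ℝ) ^ 3) = 1152 / 5000 / (k : ℝ) * (1 / k) := by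
    field_simp
    norm_num
  rw [h3]
  refine mul_le_of_le_one_left (by positivity) ?_
  rw [div_le_one hkpos]
  linarith

end Characters

/-! ### The two vector group topologies and their comparison. -/

section Topologies

variable {G : Type u} [AddCommGroup G] [TopologicalSpace G]

lemma CharGroup.continuous_eval (χ : CharGroup G) : Continuous χ.eval :=
  (map_continuous χ).comp continuous_ofAdd

lemma exists_nhds_abs_le_of_mem_setY (hG : IsLocallyQuasiConvex G)
    (χ : CharGroup G) {ε : ℝ} (hε : 0 < ε) :
    ∃ U ∈ 𝓝 (0 : G), IsQuasiConvex U ∧ ∀ x ∈ setY U, |x χ| ≤ ε := by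
  -- The bound `1/4` puts `χ` in the polar of `U` and makes its lift unique.
  set r : ℝ := min ε (1 / 4) with hr
  have hr0 : 0 < r := lt_min hε (by norm_num)
  have hcont : ContinuousAt (fun g : G => circleLift (χ.eval g)) 0 := by
    have h1 : ContinuousAt (fun g : G => Complex.arg (χ.eval g : ℂ)) 0 := by
      refine ContinuousAt.comp (g := Complex.arg) ?_
        (continuous_subtype_val.comp χ.continuous_eval).continuousAt
      apply Complex.continuousAt_arg
      simp [CharGroup.eval_zero]
    exact h1.div_const _
  have hnhds : {g : G | |circleLift (χ.eval g)| < r} ∈ 𝓝 (0 : G) := by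
    have h0 : circleLift (χ.eval (0 : G)) = 0 := by simp [CharGroup.eval_zero, circleLift]
    have := hcont (Metric.ball_mem_nhds _ hr0)
    rw [Filter.mem_map] at this
    filter_upwards [this] with g hg
    simpa [Real.dist_eq, h0] using hg
  obtain ⟨U, hU, hUq, hUsub⟩ := hG _ hnhds
  have hχ : χ ∈ groupPolar U := by
    intro g hg
    rw [← exp_circleLift (χ.eval g)]
    exact mem_circlePos_of_abs_le ((hUsub hg).le.trans (min_le_right _ _))
  refine ⟨U, hU, hUq, ?_⟩
  have hsub : setY U ⊆ {x | x χ ∈ Set.Icc (-ε) ε} := by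
    refine convexHull_min ?_
      ((convex_Icc (-ε) ε).linear_preimage (LinearMap.proj χ : (CharGroup G → ℝ) →ₗ[ℝ] ℝ))
    rintro x ⟨g, hg, hx⟩
    obtain ⟨h1, h2⟩ := hx χ hχ
    have h3 : |circleLift (χ.eval g)| < r := hUsub hg
    change x χ ∈ Set.Icc (-ε) ε
    rw [Set.mem_Icc, ← abs_le,
      eq_of_circleExp_eq h2 (h3.le.trans (min_le_right _ _)) (h1.trans (exp_circleLift _).symm)]
    exact h3.le.trans (min_le_left _ _)
  exact fun x hx => abs_le.2 (hsub hx)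

lemma isSymmConvex_setY {U : Set G} (hU : IsQuasiConvex U) : IsSymmConvex (setY U) :=
  isSymmConvex_convexHull fun _ hx => neg_mem_setX hU hx

lemma isSymmConvex_convexHull_setX_inter {U : Set G} (hU : IsQuasiConvex U) :
    IsSymmConvex (convexHull ℝ (setX U ∩ setH₀ G)) :=
  isSymmConvex_convexHull fun _ hx => ⟨neg_mem_setX hU hx.1, neg_mem_setH₀ hx.2⟩

theorem isLocallyConvexVectorGroup_topologyY [IsTopologicalAddGroup G]
    (hG : IsLocallyQuasiConvex G) :
    IsLocallyConvexVectorGroup (CharGroup G → ℝ) (topologyY hG) := by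
  let := topologyY hG
  have : IsTopologicalAddGroup (CharGroup G → ℝ) := (filterBasisY hG).isTopologicalAddGroup
  refine ⟨this, IsTopologicalAddGroup.t2Space_of_zero_sep fun x hx => ?_, fun U hU => ?_⟩
  · obtain ⟨χ, hχ⟩ := Function.ne_iff.1 hx
    have hpos : 0 < |x χ| := abs_pos.2 hχ
    obtain ⟨U, hU, hUq, h⟩ := exists_nhds_abs_le_of_mem_setY hG χ (half_pos hpos)
    refine ⟨setY U, (mem_nhds_topologyY hG _).2 ⟨U, hU, hUq, subset_rfl⟩, fun hxU => ?_⟩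
    linarith [h x hxU]
  · obtain ⟨W, hW, hWq, hWU⟩ := (mem_nhds_topologyY hG _).1 hU
    exact ⟨setY W, (mem_nhds_topologyY hG _).2 ⟨W, hW, hWq, subset_rfl⟩, isSymmConvex_setY hWq, hWU⟩

theorem isLocallyConvexVectorGroup_topologyV₀ [IsTopologicalAddGroup G]
    (hG : IsLocallyQuasiConvex G) :
    IsLocallyConvexVectorGroup (CharGroup G → ℝ) (topologyV₀ hG) := by
  let := topologyV₀ hG
  have : IsTopologicalAddGroup (CharGroup G → ℝ) := (filterBasisV₀ hG).isTopologicalAddGroup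
  refine ⟨this, IsTopologicalAddGroup.t2Space_of_zero_sep fun x hx => ?_, fun U hU => ?_⟩
  · obtain ⟨χ, hχ⟩ := Function.ne_iff.1 hx
    have hpos : 0 < |x χ| := abs_pos.2 hχ
    obtain ⟨U, hU, hUq, h⟩ := exists_nhds_abs_le_of_mem_setY hG χ (half_pos hpos)
    refine ⟨_, (mem_nhds_topologyV₀ hG _).2 ⟨U, hU, hUq, subset_rfl⟩, fun hxU => ?_⟩
    linarith [h x (convexHull_mono Set.inter_subset_left hxU)]
  · obtain ⟨W, hW, hWq, hWU⟩ := (mem_nhds_topologyV₀ hG _).1 hU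
    exact ⟨_, (mem_nhds_topologyV₀ hG _).2 ⟨W, hW, hWq, subset_rfl⟩,
      isSymmConvex_convexHull_setX_inter hWq, hWU⟩

theorem IsNuclearGroup.isNuclearVectorGroup_topologyV₀ [IsTopologicalAddGroup G]
    (hG : IsLocallyQuasiConvex G)
    (h : IsNuclearGroup G) : IsNuclearVectorGroup (CharGroup G → ℝ) (topologyV₀ hG) := by
  refine ⟨isLocallyConvexVectorGroup_topologyV₀ hG, fun S hS _ => ?_⟩
  obtain ⟨U, hU, hUq, hUS⟩ := (mem_nhds_topologyV₀ hG _).1 hS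
  obtain ⟨W, hW, hWq, hWU⟩ := h.exists_approxBy hG hU hUq
  refine ⟨_, (mem_nhds_topologyV₀ hG _).2 ⟨W, hW, hWq, subset_rfl⟩,
    isSymmConvex_convexHull_setX_inter hWq, fun k hk => ?_⟩
  have hkpos : (0 : ℝ) < k := by exact_mod_cast hk
  refine (kolmogoroffNumber_le_of_approxBy (by positivity)
    ((hWU k hk).mono_right hUS)).trans_eq ?_
  rw [ENNReal.ofReal_div_of_pos hkpos]
  simp

/-- Two points agreeing on the polar of `U` belong to `X_U` simultaneously. -/
lemma setX_congr {U : Set G} {x y : CharGroup G → ℝ} (hx : x ∈ setX U)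
    (h : ∀ χ ∈ groupPolar U, y χ = x χ) : y ∈ setX U := by
  obtain ⟨g, hg, hx⟩ := hx
  exact ⟨g, hg, fun χ hχ => by rw [h χ hχ]; exact hx χ hχ⟩

/-- Coordinates outside the polar are unconstrained in `X_U`, so they may be replaced by lifts of
`χ(g)`. -/
lemma exists_mem_setX_inter_setH₀ {U : Set G} {x : CharGroup G → ℝ} (hx : x ∈ setX U) :
    ∃ y ∈ setX U ∩ setH₀ G, ∀ χ ∈ groupPolar U, y χ = x χ := by
  classical
  obtain ⟨g, hg, hx'⟩ := hx
  set y : CharGroup G → ℝ := fun χ => if χ ∈ groupPolar U then x χ else circleLift (χ.eval g)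
    with hy
  have hyx : ∀ χ ∈ groupPolar U, y χ = x χ := fun χ hχ => by simp [hy, hχ]
  refine ⟨y, ⟨setX_congr ⟨g, hg, hx'⟩ hyx, g, fun χ => ?_⟩, hyx⟩
  by_cases hχ : χ ∈ groupPolar U
  · rw [hyx χ hχ]
    exact (hx' χ hχ).1
  · simp only [hy, hχ, if_false]
    exact exp_circleLift _

/-- The functions vanishing on a set of characters. -/
def vanishingOn (B : Set (CharGroup G)) : Submodule ℝ (CharGroup G → ℝ) where
  carrier := {x | ∀ χ ∈ B, x χ = 0}
  zero_mem' := fun _ _ => rfl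
  add_mem' := fun hx hy χ hχ => by simp [hx χ hχ, hy χ hχ]
  smul_mem' := fun c x hx χ hχ => by simp [hx χ hχ]

lemma setY_add_vanishingOn_subset (U : Set G) :
    setY U + (vanishingOn (groupPolar U) : Set (CharGroup G → ℝ)) ⊆ setY U := by
  rw [setY, ← (vanishingOn (groupPolar U)).convex.convexHull_eq, ← convexHull_add]
  refine convexHull_mono ?_
  rintro _ ⟨x, hx, y, hy, rfl⟩
  exact setX_congr hx fun χ hχ => by simp [hy χ hχ]

lemma setY_subset_add_vanishingOn {U W : Set G} (hWU : W ⊆ U) :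
    setY W ⊆ convexHull ℝ (setX W ∩ setH₀ G) +
      (vanishingOn (groupPolar U) : Set (CharGroup G → ℝ)) := by
  refine convexHull_min (fun x hx => ?_)
    ((convex_convexHull ℝ _).add (vanishingOn (groupPolar U)).convex)
  obtain ⟨y, hy, hyx⟩ := exists_mem_setX_inter_setH₀ hx
  refine Set.mem_add.2 ⟨y, subset_convexHull ℝ _ hy, x - y, fun χ hχ => ?_, by abel⟩
  simp [hyx χ (groupPolar_anti hWU hχ)]

theorem isNuclearVectorGroup_topologyY_of_topologyV₀ [IsTopologicalAddGroup G]
    (hG : IsLocallyQuasiConvex G)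
    (h : IsNuclearVectorGroup (CharGroup G → ℝ) (topologyV₀ hG)) :
    IsNuclearVectorGroup (CharGroup G → ℝ) (topologyY hG) := by
  refine ⟨isLocallyConvexVectorGroup_topologyY hG, fun S hS _ => ?_⟩
  obtain ⟨U, hU, hUq, hUS⟩ := (mem_nhds_topologyY hG _).1 hS
  obtain ⟨R, hR, -, hRU⟩ := h.2 _ ((mem_nhds_topologyV₀ hG _).2 ⟨U, hU, hUq, subset_rfl⟩)
    (isSymmConvex_convexHull_setX_inter hUq)
  obtain ⟨W', hW', hWq', hWR⟩ := (mem_nhds_topologyV₀ hG _).1 hR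
  set W := W' ∩ U with hW
  have hWq : IsQuasiConvex W := hWq'.inter hUq
  refine ⟨setY W, (mem_nhds_topologyY hG _).2 ⟨W, Filter.inter_mem hW' hU, hWq, subset_rfl⟩,
    isSymmConvex_setY hWq, fun k hk => le_trans (sInf_le_sInf ?_) (hRU k hk)⟩
  rintro _ ⟨c, hc, rfl, L, hL, hRL⟩
  refine ⟨c, hc, rfl, L, hL, fun x hx => ?_⟩
  obtain ⟨y, hy, v, hv, rfl⟩ := setY_subset_add_vanishingOn (Set.inter_subset_right : W ⊆ U) hx
  have hyR : y ∈ R := hWR (convexHull_mono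
    (Set.inter_subset_inter_left _ (setX_mono Set.inter_subset_left)) hy)
  obtain ⟨_, ⟨w, hw, rfl⟩, l, hl, rfl⟩ := hRL hyR
  -- The vanishing part `v` is absorbed into `c • Y_U`, which is invariant under such translations.
  refine Set.mem_add.2 ⟨c • (w + c⁻¹ • v), ⟨_, hUS ?_, rfl⟩, l, hl, ?_⟩
  · exact setY_add_vanishingOn_subset U (Set.add_mem_add
      (convexHull_mono Set.inter_subset_left hw) (Submodule.smul_mem _ _ hv))
  · rw [smul_add, smul_inv_smul₀ hc.ne']
    simp only
    abel

end Topologies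

/-! ### Composing estimates and improving the rate of decay. -/

section Composition

variable {E : Type*} [AddCommGroup E] [Module ℝ E]

/-- Approximate by `L`, then approximate the remainder by `M`. Dimensions below `k` and `l` add up
to at most `k + l - 2`, which is below `n`. -/
lemma ApproxBy.trans {X Y Z : Set E} {k l n : ℕ} {a b : ℝ} (hXY : ApproxBy k a X Y)
    (hYZ : ApproxBy l b Y Z) (hn : k + l ≤ n + 1) : ApproxBy n (a * b) X Z := by
  obtain ⟨L, hL, hX⟩ := hXY
  obtain ⟨M, hM, hY⟩ := hYZ
  have hLfin : FiniteDimensional ℝ L :=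
    Module.rank_lt_aleph0_iff.1 (hL.trans Cardinal.natCast_lt_aleph0)
  have hMfin : FiniteDimensional ℝ M :=
    Module.rank_lt_aleph0_iff.1 (hM.trans Cardinal.natCast_lt_aleph0)
  refine ⟨L ⊔ M, ?_, fun x hx => ?_⟩
  · rw [← Module.finrank_eq_rank] at hL hM ⊢
    have hL' : Module.finrank ℝ L < k := by exact_mod_cast hL
    have hM' : Module.finrank ℝ M < l := by exact_mod_cast hM
    have := Submodule.finrank_add_le_finrank_add_finrank L M
    have h : Module.finrank ℝ ↥(L ⊔ M) < n := by omega
    exact_mod_cast h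
  · obtain ⟨_, ⟨y, hy, rfl⟩, l, hl, rfl⟩ := hX hx
    obtain ⟨_, ⟨z, hz, rfl⟩, m, hm, rfl⟩ := hY hy
    refine Set.mem_add.2 ⟨(a * b) • z, ⟨z, hz, rfl⟩, l + a • m, ?_, ?_⟩
    · exact add_mem (Submodule.mem_sup_left hl) (Submodule.mem_sup_right (M.smul_mem a hm))
    · simp only [smul_add, smul_smul]
      abel

/-- In a vector group scaling is not assumed continuous; halving a neighborhood comes instead from
continuity of addition, since `x + x ∈ W` puts `x` in `W / 2`. -/
lemma IsLocallyConvexVectorGroup.exists_subset_smul {t : TopologicalSpace E}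
    (h : IsLocallyConvexVectorGroup E t) {c : ℝ} (hc : 0 < c) {U : Set E} (hU : U ∈ 𝓝 (0 : E))
    (hUs : IsSymmConvex U) : ∃ W ∈ 𝓝 (0 : E), IsSymmConvex W ∧ W ⊆ c • U := by
  have := h.1
  have hiter : ∀ n : ℕ, ∃ W ∈ 𝓝 (0 : E), IsSymmConvex W ∧ W ⊆ (1 / 2 : ℝ) ^ n • U := by
    intro n
    induction n with
    | zero => exact ⟨U, hU, hUs, by simp⟩
    | succ n ih =>
      obtain ⟨W, hW, -, hWU⟩ := ih
      obtain ⟨V, hV, hVW⟩ := exists_nhds_zero_half hW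
      obtain ⟨V', hV', hVs', hVV'⟩ := h.2.2 V hV
      refine ⟨V', hV', hVs', fun x hx => ?_⟩
      obtain ⟨y, hy, hxy⟩ := hWU (hVW x (hVV' hx) x (hVV' hx))
      refine ⟨y, hy, ?_⟩
      simp only at hxy ⊢
      rw [pow_succ', mul_smul, hxy, ← two_smul ℝ x, smul_smul]
      norm_num
  obtain ⟨n, hn⟩ := exists_pow_lt_of_lt_one hc (by norm_num : (1 / 2 : ℝ) < 1)
  obtain ⟨W, hW, hWs, hWU⟩ := hiter n
  exact ⟨W, hW, hWs, hWU.trans (hUs.smul_mono (mem_of_mem_nhds hU) (by positivity) hn.le)⟩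

/-- In a nuclear vector group the numbers `d_k(W, U)` can be made to decrease faster than any
power of `k`. -/
theorem IsNuclearVectorGroup.exists_approxBy {t : TopologicalSpace E}
    (h : IsNuclearVectorGroup E t) (m : ℕ) {c : ℝ} (hc : 0 < c) {U : Set E} (hU : U ∈ 𝓝 (0 : E))
    (hUs : IsSymmConvex U) :
    ∃ W ∈ 𝓝 (0 : E), IsSymmConvex W ∧ ∀ k : ℕ, 1 ≤ k → ApproxBy k (c / (k : ℝ) ^ m) W U := by
  induction m generalizing c with
  | zero =>
    obtain ⟨W, hW, hWs, hWU⟩ := h.1.exists_subset_smul hc hU hUs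
    refine ⟨W, hW, hWs, fun k hk => ⟨⊥, ?_, by simpa using hWU⟩⟩
    rw [rank_bot]
    exact_mod_cast hk
  | succ m ih =>
    -- With `k = ⌈n / 2⌉` two estimates at level `k` compose to one at level `n`. The power of `2`
    -- absorbs `n ≤ 2 k` and the `2 / k` that replaces the infimum bound `1 / k`.
    obtain ⟨V, hV, hVs, hVU⟩ := ih (c := c / 2 ^ (m + 2)) (by positivity)
    obtain ⟨W, hW, hWs, hWV⟩ := h.2 V hV hVs
    refine ⟨W, hW, hWs, fun n hn => ?_⟩
    set k := (n + 1) / 2 with hk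
    have hk1 : 1 ≤ k := by omega
    have hkpos : (0 : ℝ) < k := by exact_mod_cast hk1
    have hnpos : (0 : ℝ) < n := by exact_mod_cast hn
    have h1 : ApproxBy k (2 / (k : ℝ)) W V := by
      refine approxBy_of_kolmogoroffNumber_lt hVs ((hWV k hk1).trans_lt ?_) (mem_of_mem_nhds hV)
      have : 1 / (k : ℝ≥0∞) = ENNReal.ofReal (1 / k) := by
        rw [ENNReal.ofReal_div_of_pos hkpos]
        simp
      rw [this, ENNReal.ofReal_lt_ofReal_iff (by positivity)]
      gcongr
      norm_num
    refine (h1.trans (hVU k hk1) (by omega : k + k ≤ n + 1)).mono_const hUs (mem_of_mem_nhds hU)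
      (by positivity) ?_
    have h2 : (n : ℝ) ≤ 2 * k := by
      have : n ≤ 2 * k := by omega
      exact_mod_cast this
    calc 2 / (k : ℝ) * (c / 2 ^ (m + 2) / (k : ℝ) ^ m) = c / (2 * k) ^ (m + 1) := by
          rw [mul_pow, pow_succ (k : ℝ), pow_succ (2 : ℝ) (m + 1)]
          field_simp
      _ ≤ c / (n : ℝ) ^ (m + 1) := by gcongr

end Composition

/-! ### The natural homomorphism from `H₀` onto `G`. -/

section Quotient

variable {G : Type u} [AddCommGroup G] [TopologicalSpace G]

lemma IsLocallyQuasiConvex.eq_zero_of_eval_eq_one [T2Space G] (hG : IsLocallyQuasiConvex G)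
    {g : G} (hg : ∀ χ : CharGroup G, χ.eval g = 1) : g = 0 := by
  by_contra hne
  obtain ⟨V, hV, hVq, hVg⟩ := hG {g}ᶜ (isOpen_compl_singleton.mem_nhds (Ne.symm hne))
  refine hVg ?_ rfl
  rw [hVq]
  intro χ _
  rw [hg χ]
  simp [circlePos]

/-- Characters separate the points of `G`, so the group element belonging to a point of `H₀` is
unique and depends additively on it. -/
lemma IsLocallyQuasiConvex.exists_quotient_hom [T2Space G] (hG : IsLocallyQuasiConvex G) :
    ∃ φ : subgroupH₀ G →+ G, ∀ (x : subgroupH₀ G) (χ : CharGroup G),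
      χ.eval (φ x) = Circle.exp (2 * Real.pi * (x : CharGroup G → ℝ) χ) := by
  choose f hf using fun x : subgroupH₀ G => x.2
  refine ⟨AddMonoidHom.mk' f fun x y => ?_, fun x χ => (hf x χ).symm⟩
  rw [← sub_eq_zero]
  refine hG.eq_zero_of_eval_eq_one fun χ => ?_
  rw [sub_eq_add_neg, CharGroup.eval_add, CharGroup.eval_neg, CharGroup.eval_add, ← hf, ← hf,
    ← hf, AddSubgroup.coe_add, Pi.add_apply, mul_add, Circle.exp_add, mul_inv_cancel]

theorem isNuclearGroup_of_topologyY [IsTopologicalAddGroup G] [T2Space G]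
    (hG : IsLocallyQuasiConvex G)
    (h : IsNuclearVectorGroup (CharGroup G → ℝ) (topologyY hG)) : IsNuclearGroup G := by
  refine ⟨inferInstance, inferInstance, fun m _ c hc S hS => ?_⟩
  obtain ⟨U, hU, hUq, hUS⟩ := hG S hS
  have hUY := (mem_nhds_topologyY hG _).2 ⟨U, hU, hUq, subset_rfl⟩
  obtain ⟨R, hR, hRs, hRU⟩ := h.exists_approxBy m hc hUY (isSymmConvex_setY hUq)
  obtain ⟨W, hW, -, hWR⟩ := (mem_nhds_topologyY hG _).1 hR
  obtain ⟨φ, hφ⟩ := hG.exists_quotient_hom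
  refine ⟨W, hW, CharGroup G → ℝ, inferInstance, inferInstance, R, setY U, subgroupH₀ G, φ, hRs,
    isSymmConvex_setY hUq, fun k hk => ?_, fun g hg => ?_, ?_⟩
  · have hkpos : (0 : ℝ) < k := by exact_mod_cast hk
    exact kolmogoroffNumber_le_of_approxBy (by positivity) (hRU k hk)
  -- The lift with coordinates in `(-1/2, 1/2]` lies in `X_W`, because for `χ` in the polar of `W`
  -- its coordinate has modulus at most `1/4`.
  · let x : subgroupH₀ G := ⟨fun χ => circleLift (χ.eval g), g, fun χ => exp_circleLift _⟩
    refine ⟨x, hWR (subset_convexHull ℝ _ ⟨g, hg, fun χ hχ => ⟨exp_circleLift _, ?_⟩⟩), ?_⟩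
    · exact abs_circleLift_le_quarter (hχ g hg)
    · rw [← sub_eq_zero]
      refine hG.eq_zero_of_eval_eq_one fun χ => ?_
      rw [sub_eq_add_neg, CharGroup.eval_add, CharGroup.eval_neg, hφ]
      simp only [x, exp_circleLift, mul_inv_cancel]
  · rintro _ ⟨x, hx, rfl⟩
    apply hUS
    rw [hUq]
    intro χ hχ
    rw [hφ]
    apply mem_circlePos_of_abs_le
    have hsub : setY U ⊆ {x | x χ ∈ Set.Icc (-(1 / 4) : ℝ) (1 / 4)} :=
      convexHull_min (fun x ⟨_, _, hx⟩ => abs_le.1 (hx χ hχ).2)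
        ((convex_Icc _ _).linear_preimage (LinearMap.proj χ : (CharGroup G → ℝ) →ₗ[ℝ] ℝ))
    exact abs_le.2 (hsub hx)

end Quotient

end

theorem mainTheorem9 {G : Type u} [AddCommGroup G] [TopologicalSpace G]
    [IsTopologicalAddGroup G] [T2Space G] (hG : IsLocallyQuasiConvex G) :
    List.TFAE
      [IsNuclearGroup G,
       IsNuclearVectorGroup (CharGroup G → ℝ) (topologyY hG),
       IsNuclearVectorGroup (CharGroup G → ℝ) (topologyV₀ hG)] := by
  tfae_have 1 → 3 := IsNuclearGroup.isNuclearVectorGroup_topologyV₀ hG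
  tfae_have 3 → 2 := isNuclearVectorGroup_topologyY_of_topologyV₀ hG
  tfae_have 2 → 1 := isNuclearGroup_of_topologyY hG
  tfae_finish
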